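/- Let $G=(V,E)$ be a finite simple undirected graph with $n=|V|\ge 3$ vertices and $m=|E|\ge 1$ edges, let $p\in(0,1)^E$, $\lambda\in[0,1)^V$ and $0<\epsilon\le\frac12$. Write $p_{\min}=\min_{e\in E}p_e$ and $\lambda_{\max}=\max_{v\in V}\lambda_v$; $\log$ is the natural logarithm. Let $\mu$ be the random cluster distribution on subsets of $E$, that is $$\mu(S)\;\propto\;\prod_{e\in S}p_e\prod_{e\in E\setminus S}(1-p_e)\prod_{C\in\kappa(V,S)}\Bigl(1+\prod_{j\in C}\lambda_j\Bigr),$$ where $\kappa(V,S)$ is the set of connected components of $(V,S)$, and put $\mu_e^X=\dfrac{\mu(X\cup\{e\})}{\mu(X\cup\{e\})+\mu(X\setminus\{e\})}$ for $e\in E$, $X\subseteq E$. For integers $T^{GD},T^{PA}\ge 1$ consider the following algorithm. Draw $X'\subseteq E$ by including each $e\in E$ independently with probability $\mu_e^E$, and draw, independently of $X'$ and of each other, $e_1,\dots,e_{T^{GD}}$ uniform in $E$ and $R_1,\dots,R_{T^{GD}}$ uniform in $[0,1]$. For $e\in E$ let $\mathrm{pred}_i(e)=\max(\{j\ge1: j<i,\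 e_j=e\}\cup\{0\})$ and $j_e=\max(\{j\ge 1: e_j=e\}\cup\{0\})$. Set $Y^0_i=1$ if $e_i\in X'$ and $Y_i^0=0$ otherwise. For $t=1,\dots,T^{PA}$ and all $1\le i\le T^{GD}$ (in parallel) let $\sigma_i^t$ be the set of all $e\in E$ such that either $\mathrm{pred}_i(e)=0$ and $e\in X'$, or $\mathrm{pred}_i(e)\ge1$ and $Y^{t-1}_{\mathrm{pred}_i(e)}=1$, and set $Y^t_i=1$ if $R_i<\mu_{e_i}^{\sigma_i^t}$ and $Y_i^t=0$ otherwise. The output $X^{\mathrm{ALG}}$ is the set of all $e\in E$ such that either $j_e=0$ and $e\in X'$, or $j_e\ge1$ and $Y^{T^{PA}}_{j_e}=1$. Theorem. Assume $$(1-p_{\min})\log n\;\le\;\min\Bigl\{e^{-40}\exp\Bigl(-\frac{5\log(1/\epsilon)}{\log n}\Bigr),\ \frac{1-\lambda_{\max}}{27}\Bigr\}.$$ Then for all integers $T^{GD}\ge\lceil 2m(\log m+\log(4/\epsilon))\rceil$ and $T^{PA}\ge\lceil 3\log(4T^{GD}/\epsilon)\rceil$, $$d_{TV}(X^{\mathrm{ALG}},\mu)=\frac12\sum_{S\subseteq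 E}\bigl|\Pr[X^{\mathrm{ALG}}=S]-\mu(S)\bigr|\;\le\;\epsilon .$$ -/

import Mathlib

noncomputable section

namespace ParallelRC

/-! ### The random cluster model -/

section Model

variable {V : Type*} [Fintype V] [DecidableEq V] (G : SimpleGraph V) [DecidableRel G.Adj]

/-- The spanning subgraph `(V, S)` for a set `S` of edges of `G`. -/
def spanning (S : Finset G.edgeSet) : SimpleGraph V :=
  SimpleGraph.fromEdgeSet {x : Sym2 V | ∃ e ∈ S, (e : Sym2 V) = x}

open Classical in
/-- The weight `∏_{e ∈ S} p_e · ∏_{e ∉ S} (1 - p_e) · ∏_C (1 + ∏_{j ∈ C} λ_j)`, where `C` runs over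
the connected components of `(V, S)`. -/
def rcWeight (p : G.edgeSet → ℝ) (lam : V → ℝ) (S : Finset G.edgeSet) : ℝ :=
  (∏ e ∈ S, p e) * (∏ e ∈ Finset.univ \ S, (1 - p e)) *
    ∏ C : (spanning G S).ConnectedComponent,
      (1 + ∏ j with (spanning G S).connectedComponentMk j = C, lam j)

/-- The random cluster distribution on subsets of the edge set of `G`. -/
def rcDist (p : G.edgeSet → ℝ) (lam : V → ℝ) (S : Finset G.edgeSet) : ℝ :=
  rcWeight G p lam S / ∑ T : Finset G.edgeSet, rcWeight G p lam T

end Model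

/-! ### The parallel sampler, for a distribution `μ` on subsets of a finite set `E` -/

section Sampler

variable {E : Type*} [Fintype E] [DecidableEq E]

/-- The marginal probability `μ(X ∪ {e}) / (μ(X ∪ {e}) + μ(X \ {e}))` of `e` given `X`. -/
def marginal (μ : Finset E → ℝ) (e : E) (X : Finset E) : ℝ :=
  μ (insert e X) / (μ (insert e X) + μ (X.erase e))

/-- `pred_i(x) = max {j < i : e_j = x}`, where `⊥` says that there is no such `j`. (Time steps are
indexed by `Fin T`; `⊥` plays the role of the time `0` that precedes all of them.) -/
def pred {T : ℕ} (e : Fin T → E) (i : Fin T) (x : E) : WithBot (Fin T) :=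
  (Finset.univ.filter fun j => j < i ∧ e j = x).max

/-- `max {j : e_j = x}`, where `⊥` says that there is no such `j`. -/
def last {T : ℕ} (e : Fin T → E) (x : E) : WithBot (Fin T) :=
  (Finset.univ.filter fun j => e j = x).max

/-- The configuration in which the status of `x` is read off from the update number `j x`, or from
the initial configuration `X₀` if `j x = ⊥`. -/
def readConfig {T : ℕ} (X₀ : Finset E) (Y : Fin T → Bool) (j : E → WithBot (Fin T)) : Finset E :=
  Finset.univ.filter fun x =>
    (j x = ⊥ ∧ x ∈ X₀) ∨ ∃ k : Fin T, j x = (k : WithBot (Fin T)) ∧ Y k = true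

/-- The values `Y^t_i` after `t` rounds of simultaneous re-evaluation of all the updates, given the
initial configuration `X₀`, the update sites `e_i` and the thresholds `R_i`. -/
def rounds (μ : Finset E → ℝ) {T : ℕ} (X₀ : Finset E) (e : Fin T → E) (R : Fin T → unitInterval) :
    ℕ → Fin T → Bool
  | 0 => fun i => decide (e i ∈ X₀)
  | t + 1 => fun i =>
      decide ((R i : ℝ) < marginal μ (e i) (readConfig X₀ (rounds μ X₀ e R t) (pred e i)))

/-- The set returned by the sampler after `TPA` rounds. -/
def output (μ : Finset E → ℝ) {T : ℕ} (TPA : ℕ)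
    (X₀ : Finset E) (e : Fin T → E) (R : Fin T → unitInterval) : Finset E :=
  readConfig X₀ (rounds μ X₀ e R TPA) (last e)

/-- The law of a bit that is `true` with probability `q`, for `0 ≤ q ≤ 1`. -/
def bitLaw (q : ℝ) : MeasureTheory.Measure Bool :=
  ENNReal.ofReal q • MeasureTheory.Measure.dirac true +
    ENNReal.ofReal (1 - q) • MeasureTheory.Measure.dirac false

/-- The law of the random bits of the sampler, all independent: the indicators of the initial
configuration, where `x` is included with probability `marginal μ x E`; the `T` update sites, each
uniform on `E`; and the `T` thresholds, each uniform on `[0, 1]`. -/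
def seedLaw [Nonempty E] [MeasurableSpace E] (μ : Finset E → ℝ) (T : ℕ) :
    MeasureTheory.Measure ((E → Bool) × (Fin T → E) × (Fin T → unitInterval)) :=
  (MeasureTheory.Measure.pi fun x : E => bitLaw (marginal μ x Finset.univ)).prod
    ((MeasureTheory.Measure.pi fun _ : Fin T => (PMF.uniformOfFintype E).toMeasure).prod
      (MeasureTheory.Measure.pi fun _ : Fin T => MeasureTheory.volume))

/-- The probability that the sampler, run with `TGD` updates and `TPA` rounds, returns `S`. -/
def outputProb [Nonempty E] (μ : Finset E → ℝ) (TGD TPA : ℕ) (S : Finset E) : ℝ :=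
  letI : MeasurableSpace E := ⊤
  (seedLaw μ TGD).real
    {ω | output μ TPA (Finset.univ.filter fun x => ω.1 x = true) ω.2.1 ω.2.2 = S}

/-- Total variation distance of two distributions on subsets of `E`. -/
def tvDist (P Q : Finset E → ℝ) : ℝ :=
  (1 / 2) * ∑ S : Finset E, |P S - Q S|

end Sampler

end ParallelRC

end

noncomputable section

namespace ParallelRC

set_option linter.unusedSectionVars false

open MeasureTheory

/-! The updates are exposed in time order rather than round by round. After i updates, each round t
has a current configuration. The next update is a heat-bath step in round t+1 whose probability is
read off round t, and all rounds share its site and threshold. So the rounds together form a Markov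
chain. One adds to it a copy (`base`) of the sequential Glauber dynamics with the same sites and
thresholds, started from μ. The base keeps law μ, so the total variation distance is at most the
expected number D of edges where the last round and the base differ (`tvDist_outputProb_le`).

An update erases the disagreement at a uniform edge, and recreates one there with probability |μ_e^S
− μ_e^W|, where S is the previous round and W the base. If these differences sum to at most |S △
W|/2, then, with m edges, D_{i+1}^{t+1} ≤ (1 − 1/m) D_i^{t+1} + D_i^t/(2m), hence D_i^t ≤ m((1 −
1/(2m))^i + 2^{-t}).

This contraction (`sum_abs_marginal_sub_le`) holds when every component of S and of W has at most L
= log n boundary edges per vertex. Adding an edge uv affects μ_e only if e leaves the component of u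
or of v formed without e, and then by at most (1 − p_e) times the λ-weights of the components
involved, which decay geometrically with size. If e is present it is a bridge, and at most k bridges
cut off a side of size at most k (`card_bridges_le`). If e is absent it is one of few boundary
edges.

Large boundaries are rare. With q = 1 − p_min every marginal is at least 1 − 2q, so the base and all
rounds stochastically dominate independent percolation with parameter 1 − 2q at all times, and
having a large boundary is a decreasing event (`SmallBoundary.mono`). A union bound over clusters,
whose number is controlled by percolation at parameter 1/2 (`sum_half_pow_components_le`), makes its
probability tiny. -/

/-! ### Iterated random maps on a finite state space -/

section RandomMaps

variable {A : Type*} {St : Type*}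

/-- The state reached from `s` by applying `step (ω 0)`, `step (ω 1)`, … in this order. -/
def runSteps (step : A → St → St) : (T : ℕ) → (Fin T → A) → St → St
  | 0, _, s => s
  | T + 1, ω, s => runSteps step T (fun i => ω i.succ) (step (ω 0) s)

/-- The Markov operator of a random map. -/
def stepOp [MeasurableSpace A] (κ : Measure A) (step : A → St → St) (F : St → ℝ) (s : St) : ℝ :=
  ∫ a, F (step a s) ∂κ

variable [MeasurableSpace A] [Finite St] [MeasurableSpace St] [DiscreteMeasurableSpace St]

lemma integrable_comp_of_finite {Ω : Type*} [MeasurableSpace Ω] (μ : Measure Ω)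
    [IsFiniteMeasure μ] {g : Ω → St} (hg : Measurable g) (F : St → ℝ) :
    Integrable (fun ω => F (g ω)) μ := by
  obtain ⟨C, hC⟩ := (Set.finite_range fun s => ‖F s‖).bddAbove
  exact Integrable.of_bound ((Measurable.of_discrete (f := F)).comp hg).aestronglyMeasurable C
    (Filter.Eventually.of_forall fun ω => hC ⟨g ω, rfl⟩)

variable {step : A → St → St}

lemma measurable_runSteps (hstep : ∀ s, Measurable fun a => step a s) (T : ℕ) :
    ∀ s, Measurable fun ω => runSteps step T ω s := by
  induction T with
  | zero => intro s; exact measurable_const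
  | succ T ih =>
    intro s
    have h1 : Measurable fun x : (Fin T → A) × St => runSteps step T x.1 x.2 :=
      measurable_from_prod_countable_left ih
    have h2 : Measurable fun ω : Fin (T + 1) → A =>
        ((fun i : Fin T => ω i.succ), step (ω 0) s) :=
      (measurable_pi_lambda _ fun i => measurable_pi_apply _).prodMk
        ((hstep s).comp (measurable_pi_apply 0))
    exact h1.comp h2

/-- By independence the first update `ω 0` can be integrated last; it is the outermost application
of the operator. -/
lemma integral_runSteps (κ : Measure A) [IsProbabilityMeasure κ]
    (hstep : ∀ s, Measurable fun a => step a s) (F : St → ℝ) (T : ℕ) :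
    ∀ s, ∫ ω, F (runSteps step T ω s) ∂(Measure.pi fun _ : Fin T => κ) =
      (stepOp κ step)^[T] F s := by
  induction T with
  | zero => intro s; simp [runSteps]
  | succ T ih =>
    intro s
    rw [Function.iterate_succ_apply']
    have hmp := measurePreserving_piFinSuccAbove (fun _ : Fin (T + 1) => κ) 0
    have h1 : Measurable fun x : A × (Fin T → A) => runSteps step T x.2 (step x.1 s) := by
      have h1 : Measurable fun x : (Fin T → A) × St => runSteps step T x.1 x.2 :=
        measurable_from_prod_countable_left (measurable_runSteps hstep T)
      exact h1.comp (measurable_snd.prodMk ((hstep s).comp measurable_fst))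
    have h2 := hmp.integral_comp' (fun x : A × (Fin T → A) => F (runSteps step T x.2 (step x.1 s)))
    have h3 : ∀ ω : Fin (T + 1) → A, F (runSteps step T
        ((MeasurableEquiv.piFinSuccAbove (fun _ => A) 0) ω).2
        (step ((MeasurableEquiv.piFinSuccAbove (fun _ => A) 0) ω).1 s)) =
        F (runSteps step (T + 1) ω s) := fun ω => rfl
    simp only [h3] at h2
    rw [h2, integral_prod _ (integrable_comp_of_finite _ h1 F)]
    simp only [ih]
    rfl

section Operator

variable (κ : Measure A) [IsProbabilityMeasure κ] (hstep : ∀ s, Measurable fun a => step a s)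
include hstep

lemma stepOp_mono {F F' : St → ℝ} (h : ∀ s, F s ≤ F' s) (s : St) :
    stepOp κ step F s ≤ stepOp κ step F' s :=
  integral_mono (integrable_comp_of_finite κ (hstep s) F)
    (integrable_comp_of_finite κ (hstep s) F') fun _ => h _

lemma iterate_stepOp_mono (i : ℕ) {F F' : St → ℝ} (h : ∀ s, F s ≤ F' s) (s : St) :
    (stepOp κ step)^[i] F s ≤ (stepOp κ step)^[i] F' s := by
  induction i generalizing F F' with
  | zero => exact h s
  | succ i ih => exact ih (stepOp_mono κ hstep h)

lemma stepOp_linear (c d : ℝ) (F F' : St → ℝ) :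
    stepOp κ step (fun s => c * F s + d * F' s) =
      fun s => c * stepOp κ step F s + d * stepOp κ step F' s := by
  funext s
  unfold stepOp
  rw [integral_add ((integrable_comp_of_finite κ (hstep s) F).const_mul c)
    ((integrable_comp_of_finite κ (hstep s) F').const_mul d), integral_const_mul,
    integral_const_mul]

lemma iterate_stepOp_linear (i : ℕ) (c d : ℝ) (F F' : St → ℝ) :
    (stepOp κ step)^[i] (fun s => c * F s + d * F' s) =
      fun s => c * (stepOp κ step)^[i] F s + d * (stepOp κ step)^[i] F' s := by
  induction i generalizing F F' with
  | zero => rfl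
  | succ i ih => rw [Function.iterate_succ_apply, stepOp_linear κ hstep, ih]; rfl

end Operator

end RandomMaps

/-! ### The sampler as a chain of coupled configurations -/

section Chain

variable {E : Type*} [Fintype E] [DecidableEq E]

/-- Set the status of `e` to the bit `b`. -/
def setBit (e : E) (b : Bool) (X : Finset E) : Finset E :=
  if b then insert e X else X.erase e

/-- A state of the coupled chain: a configuration of the sequential dynamics and, for each of the
rounds `0, …, N`, the configuration that this round has computed so far. -/
structure ChainState (E : Type*) (N : ℕ) where
  /-- The configuration of the sequential dynamics. -/
  base : Finset E
  /-- The configurations of the rounds. -/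
  round : Fin (N + 1) → Finset E

instance (N : ℕ) : Finite (ChainState E N) :=
  Finite.of_injective (fun s => (s.base, s.round)) fun s s' h => by
    cases s; cases s'; simpa using h

instance (N : ℕ) : MeasurableSpace (ChainState E N) := ⊤

instance (N : ℕ) : DiscreteMeasurableSpace (ChainState E N) := ⟨fun _ => trivial⟩

/-- One update of all the configurations, at the site `a.1` with the threshold `a.2`. -/
def chainStep (μ : Finset E → ℝ) (N : ℕ) (a : E × unitInterval) (s : ChainState E N) :
    ChainState E N :=
  ⟨setBit a.1 (decide ((a.2 : ℝ) < marginal μ a.1 s.base)) s.base,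
    -- Round 0 is never updated: its bits only record membership in X₀. Round t+1 looks at round t
    -- before the current update, matching the strict inequality in `pred`.
    Fin.cases (s.round 0) fun t : Fin N =>
      setBit a.1 (decide ((a.2 : ℝ) < marginal μ a.1 (s.round t.castSucc))) (s.round t.succ)⟩

lemma measurable_decide_lt (c : ℝ) : Measurable fun r : unitInterval => decide ((r : ℝ) < c) := by
  have h : MeasurableSet {r : unitInterval | (r : ℝ) < c} :=
    measurableSet_lt measurable_subtype_coe measurable_const
  refine measurable_to_bool ?_
  convert h using 1
  exact Set.ext fun r => decide_eq_true_iff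

lemma measurable_chainStep [MeasurableSpace E] [DiscreteMeasurableSpace E] (μ : Finset E → ℝ)
    (N : ℕ) (s : ChainState E N) : Measurable fun a => chainStep μ N a s := by
  refine measurable_from_prod_countable_right fun e => ?_
  let g : Bool × (Fin N → Bool) → ChainState E N := fun b =>
    ⟨setBit e b.1 s.base,
      Fin.cases (s.round 0) fun t : Fin N => setBit e (b.2 t) (s.round t.succ)⟩
  have hg : Measurable g := Measurable.of_discrete
  have hb : Measurable fun r : unitInterval => (decide ((r : ℝ) < marginal μ e s.base),
      fun t : Fin N => decide ((r : ℝ) < marginal μ e (s.round t.castSucc))) :=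
    (measurable_decide_lt _).prodMk (measurable_pi_lambda _ fun t => measurable_decide_lt _)
  exact hg.comp hb

/-- The latest update of `x` among the first `i` ones. -/
def lastBefore {T : ℕ} (e : Fin T → E) (i : ℕ) (x : E) : WithBot (Fin T) :=
  (Finset.univ.filter fun j : Fin T => (j : ℕ) < i ∧ e j = x).max

lemma lastBefore_zero {T : ℕ} (e : Fin T → E) (x : E) : lastBefore e 0 x = ⊥ := by
  simp [lastBefore]

lemma lastBefore_succ {T : ℕ} (e : Fin T → E) (i : ℕ) (hi : i < T) (x : E) :
    lastBefore e (i + 1) x = if e ⟨i, hi⟩ = x then ((⟨i, hi⟩ : Fin T) : WithBot (Fin T)) else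
      lastBefore e i x := by
  unfold lastBefore
  split_ifs with h
  · have : (Finset.univ.filter fun j : Fin T => (j : ℕ) < i + 1 ∧ e j = x) =
        insert ⟨i, hi⟩ (Finset.univ.filter fun j : Fin T => (j : ℕ) < i ∧ e j = x) := by
      ext j
      simp only [Finset.mem_filter, Finset.mem_univ, true_and, Finset.mem_insert, Fin.ext_iff]
      constructor
      · rintro ⟨h1, h2⟩
        by_cases h3 : (j : ℕ) = i
        · exact Or.inl h3
        · exact Or.inr ⟨by omega, h2⟩
      · rintro (h1 | h1)
        · have : j = ⟨i, hi⟩ := Fin.ext h1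
          exact ⟨by omega, this ▸ h⟩
        · exact ⟨by omega, h1.2⟩
    rw [this, Finset.max_insert]
    refine max_eq_left (Finset.max_le fun j hj => ?_)
    simp only [Finset.mem_filter, Finset.mem_univ, true_and] at hj
    exact WithBot.coe_le_coe.2 (Fin.le_def.2 hj.1.le)
  · congr 1
    ext j
    simp only [Finset.mem_filter, Finset.mem_univ, true_and]
    constructor
    · rintro ⟨h1, h2⟩
      refine ⟨?_, h2⟩
      by_contra h3
      have : j = ⟨i, hi⟩ := Fin.ext (by simp; omega)
      exact h (this ▸ h2)
    · rintro ⟨h1, h2⟩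
      exact ⟨by omega, h2⟩

lemma readConfig_bot {T : ℕ} (X₀ : Finset E) (Y : Fin T → Bool) (j : E → WithBot (Fin T))
    (h : ∀ x, j x = ⊥) : readConfig X₀ Y j = X₀ := by
  ext x
  simp [readConfig, h]

lemma readConfig_lastBefore_succ {T : ℕ} (X₀ : Finset E) (Y : Fin T → Bool) (e : Fin T → E)
    (i : ℕ) (hi : i < T) :
    readConfig X₀ Y (lastBefore e (i + 1)) =
      setBit (e ⟨i, hi⟩) (Y ⟨i, hi⟩) (readConfig X₀ Y (lastBefore e i)) := by
  have hx : ∀ x, x ∈ readConfig X₀ Y (lastBefore e (i + 1)) ↔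
      if e ⟨i, hi⟩ = x then Y ⟨i, hi⟩ = true else x ∈ readConfig X₀ Y (lastBefore e i) := by
    intro x
    simp only [readConfig, Finset.mem_filter, Finset.mem_univ, true_and, lastBefore_succ e i hi]
    split_ifs with h <;> simp
  ext x
  rw [hx, setBit]
  by_cases h : e ⟨i, hi⟩ = x
  · by_cases hY : Y ⟨i, hi⟩ = true <;> simp [h, hY]
  · have h' : x ≠ e ⟨i, hi⟩ := fun h'' => h h''.symm
    by_cases hY : Y ⟨i, hi⟩ = true <;> simp [h, h', hY]

/-- The state after the first `i` of the updates `ω`. -/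
def chainPrefix (μ : Finset E → ℝ) (N : ℕ) {T : ℕ} (ω : Fin T → E × unitInterval)
    (s : ChainState E N) : ℕ → ChainState E N
  | 0 => s
  | i + 1 => if h : i < T then chainStep μ N (ω ⟨i, h⟩) (chainPrefix μ N ω s i) else
      chainPrefix μ N ω s i

lemma chainPrefix_succ_succ (μ : Finset E → ℝ) (N : ℕ) {T : ℕ}
    (ω : Fin (T + 1) → E × unitInterval) (s : ChainState E N) (i : ℕ) :
    chainPrefix μ N ω s (i + 1) =
      chainPrefix μ N (fun j : Fin T => ω j.succ) (chainStep μ N (ω 0) s) i := by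
  induction i with
  | zero => simp [chainPrefix]
  | succ i ih =>
    by_cases h : i < T
    · have h' : i + 1 < T + 1 := by omega
      conv_lhs => rw [chainPrefix, dif_pos h', ih]
      conv_rhs => rw [chainPrefix, dif_pos h]
      rfl
    · have h' : ¬ i + 1 < T + 1 := by omega
      conv_lhs => rw [chainPrefix, dif_neg h', ih]
      conv_rhs => rw [chainPrefix, dif_neg h]

lemma chainPrefix_eq_runSteps (μ : Finset E → ℝ) (N : ℕ) {T : ℕ}
    (ω : Fin T → E × unitInterval) (s : ChainState E N) :
    chainPrefix μ N ω s T = runSteps (chainStep μ N) T ω s := by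
  induction T generalizing s with
  | zero => rfl
  | succ T ih => rw [chainPrefix_succ_succ, ih]; rfl

/-- This exchanges the two time directions: update i of round t+1 depends only on what round t has
produced before i, so all rounds can be run side by side in the order of i. -/
lemma chainPrefix_snd (μ : Finset E → ℝ) (N : ℕ) {T : ℕ} (ω : Fin T → E × unitInterval)
    (W X₀ : Finset E) (i : ℕ) (hi : i ≤ T) :
    ∀ t : Fin (N + 1), (chainPrefix μ N ω ⟨W, fun _ => X₀⟩ i).round t =
      readConfig X₀ (rounds μ X₀ (fun j => (ω j).1) (fun j => (ω j).2) t)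
        (lastBefore (fun j => (ω j).1) i) := by
  induction i with
  | zero =>
    intro t
    rw [readConfig_bot _ _ _ (lastBefore_zero _)]
    rfl
  | succ i ih =>
    have hi' : i < T := hi
    intro t
    rw [readConfig_lastBefore_succ _ _ _ i hi', chainPrefix, dif_pos hi']
    refine Fin.cases ?_ (fun t => ?_) t
    · rw [← ih hi'.le 0]
      have h0 : (chainPrefix μ N ω ⟨W, fun _ => X₀⟩ i).round 0 = X₀ := by
        clear ih hi hi'
        induction i with
        | zero => rfl
        | succ i ih' =>
          rw [chainPrefix]
          split_ifs
          · exact ih'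
          · exact ih'
      change (chainPrefix μ N ω ⟨W, fun _ => X₀⟩ i).round 0 = _
      rw [h0]
      by_cases hx : (ω ⟨i, hi'⟩).1 ∈ X₀ <;> simp [setBit, rounds, hx]
    · change setBit _ _ _ = _
      rw [ih hi'.le, ih hi'.le]
      rfl

/-- No round reads the base, so `W` is free; it is later averaged over the target law. -/
lemma output_eq_runSteps (μ : Finset E → ℝ) (N : ℕ) {T : ℕ} (W X₀ : Finset E) (e : Fin T → E)
    (R : Fin T → unitInterval) :
    output μ N X₀ e R =
      (runSteps (chainStep μ N) T (fun j => (e j, R j)) ⟨W, fun _ => X₀⟩).round (Fin.last N) := by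
  rw [← chainPrefix_eq_runSteps, chainPrefix_snd _ _ _ _ _ _ le_rfl]
  simp only [output, Fin.val_last]
  congr 1
  funext x
  simp [last, lastBefore]

/-- The law of an update: a uniform site and a uniform threshold. -/
def updateLaw (E : Type*) [Fintype E] [Nonempty E] [MeasurableSpace E] :
    Measure (E × unitInterval) :=
  (PMF.uniformOfFintype E).toMeasure.prod volume

instance [Nonempty E] [MeasurableSpace E] : IsProbabilityMeasure (updateLaw E) := by
  unfold updateLaw; infer_instance

/-- The law of the random subset that contains each `e` independently with probability `r e`. -/
def prodLaw (r : E → ℝ) (S : Finset E) : ℝ :=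
  (∏ e ∈ S, r e) * ∏ e ∈ Finset.univ \ S, (1 - r e)

lemma bitLaw_singleton {q : ℝ} (b : Bool) :
    bitLaw q {b} = ENNReal.ofReal (if b then q else 1 - q) := by
  cases b <;> simp [bitLaw]

lemma isProbabilityMeasure_bitLaw {q : ℝ} (h0 : 0 ≤ q) (h1 : q ≤ 1) :
    IsProbabilityMeasure (bitLaw q) :=
  ⟨by
    have : ENNReal.ofReal q + ENNReal.ofReal (1 - q) = 1 := by
      rw [← ENNReal.ofReal_add h0 (by linarith)]; simp
    simpa [bitLaw] using this⟩

lemma integral_pi_bitLaw {r : E → ℝ} (h0 : ∀ e, 0 ≤ r e) (h1 : ∀ e, r e ≤ 1)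
    (F : Finset E → ℝ) :
    ∫ b, F (Finset.univ.filter fun x => b x = true) ∂(Measure.pi fun x => bitLaw (r x)) =
      ∑ X, prodLaw r X * F X := by
  have := fun x => isProbabilityMeasure_bitLaw (h0 x) (h1 x)
  rw [integral_fintype (Integrable.of_finite)]
  let φ : (E → Bool) ≃ Finset E :=
    { toFun := fun b => Finset.univ.filter fun x => b x = true
      invFun := fun X x => decide (x ∈ X)
      left_inv := fun b => by ext x; simp
      right_inv := fun X => by ext x; simp }
  refine Fintype.sum_equiv φ _ _ fun b => ?_
  rw [smul_eq_mul]
  congr 1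
  rw [Measure.real, Measure.pi_singleton]
  simp only [bitLaw_singleton]
  rw [ENNReal.toReal_prod]
  have : ∀ x, (ENNReal.ofReal (if b x then r x else 1 - r x)).toReal =
      if b x then r x else 1 - r x := fun x =>
    ENNReal.toReal_ofReal (by split_ifs; exacts [h0 x, by linarith [h1 x]])
  simp only [this]
  rw [Finset.prod_ite, prodLaw]
  congr 1
  refine Finset.prod_congr ?_ fun _ _ => rfl
  ext x
  simp [φ]

/-- The output law of the sampler, in terms of the Markov operator of the coupled chain. -/
theorem outputProb_eq [Nonempty E] [MeasurableSpace E] [DiscreteMeasurableSpace E]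
    (μ : Finset E → ℝ) (h0 : ∀ e, 0 ≤ marginal μ e Finset.univ)
    (h1 : ∀ e, marginal μ e Finset.univ ≤ 1) (T N : ℕ) (S W : Finset E) :
    outputProb μ T N S = ∑ X, prodLaw (fun e => marginal μ e Finset.univ) X *
      (stepOp (updateLaw E) (chainStep μ N))^[T]
        (fun s => if s.round (Fin.last N) = S then 1 else 0) ⟨W, fun _ => X⟩ := by
  classical
  have hE : (⊤ : MeasurableSpace E) = ‹MeasurableSpace E› := by
    ext s; exact ⟨fun _ => MeasurableSet.of_discrete, fun _ => trivial⟩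
  unfold outputProb
  rw [hE]
  have := fun x => isProbabilityMeasure_bitLaw (h0 x) (h1 x)
  have hmeas := measurable_runSteps (measurable_chainStep μ N) T
  have hpair : Measurable fun x : (Fin T → E) × (Fin T → unitInterval) =>
      fun j => (x.1 j, x.2 j) := by fun_prop
  let g : (E → Bool) × (Fin T → E) × (Fin T → unitInterval) → ChainState E N := fun ω =>
    runSteps (chainStep μ N) T (fun j => (ω.2.1 j, ω.2.2 j))
      ⟨W, fun _ => Finset.univ.filter fun x => ω.1 x = true⟩
  have hg : Measurable g :=
    measurable_from_prod_countable_right fun b =>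
      (hmeas ⟨W, fun _ => Finset.univ.filter fun x => b x = true⟩).comp hpair
  let F : ChainState E N → ℝ := fun s => if s.round (Fin.last N) = S then 1 else 0
  have hset : {ω : (E → Bool) × (Fin T → E) × (Fin T → unitInterval) |
      output μ N (Finset.univ.filter fun x => ω.1 x = true) ω.2.1 ω.2.2 = S} =
      g ⁻¹' {s | s.round (Fin.last N) = S} := by
    ext ω
    simp only [Set.mem_ofPred_eq, Set.mem_preimage, g, output_eq_runSteps μ N W]
  have hF : ∀ ω, (g ⁻¹' {s | s.round (Fin.last N) = S}).indicator (fun _ => (1 : ℝ)) ω = F (g ω) := by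
    intro ω
    simp [Set.indicator_apply, F]
  rw [hset, ← integral_indicator_one (hg MeasurableSet.of_discrete)]
  have hF' : ∫ ω, (g ⁻¹' {s | s.round (Fin.last N) = S}).indicator 1 ω ∂(seedLaw μ T) =
      ∫ ω, F (g ω) ∂(seedLaw μ T) := integral_congr_ae (Filter.Eventually.of_forall hF)
  rw [hF']
  have : IsProbabilityMeasure (seedLaw μ T) := by unfold seedLaw; infer_instance
  unfold seedLaw
  rw [integral_prod]
  swap
  · exact integrable_comp_of_finite (seedLaw μ T) hg F
  rw [← integral_pi_bitLaw h0 h1 fun X => (stepOp (updateLaw E) (chainStep μ N))^[T] F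
    ⟨W, fun _ => X⟩]
  refine integral_congr_ae (Filter.Eventually.of_forall fun b => ?_)
  simp only
  rw [← integral_runSteps (updateLaw E) (measurable_chainStep μ N)]
  have hmp := measurePreserving_arrowProdEquivProdArrow E unitInterval (Fin T)
    (fun _ => (PMF.uniformOfFintype E).toMeasure) (fun _ => volume)
  rw [← hmp.integral_comp' fun x => F (g (b, x))]
  rfl

end Chain

/-! ### Heat-bath updates and stochastic domination by a product law -/

section HeatBath

variable {E : Type*} [Fintype E] [DecidableEq E]

lemma sum_univ_eq_sum_toggle (e : E) (h : Finset E → ℝ) :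
    ∑ S, h S = ∑ S ∈ (Finset.univ.erase e).powerset, (h S + h (insert e S)) := by
  rw [Finset.sum_add_distrib, ← Finset.sum_powerset_insert (Finset.notMem_erase e _),
    Finset.insert_erase (Finset.mem_univ e), Finset.powerset_univ]

lemma marginal_insert (ρ : Finset E → ℝ) (e : E) (X : Finset E) :
    marginal ρ e (insert e X) = marginal ρ e X := by
  simp [marginal]

lemma marginal_nonneg {ρ : Finset E → ℝ} (hρ : ∀ S, 0 < ρ S) (e : E) (X : Finset E) :
    0 ≤ marginal ρ e X :=
  (div_pos (hρ _) (add_pos (hρ _) (hρ _))).le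

lemma marginal_le_one {ρ : Finset E → ℝ} (hρ : ∀ S, 0 < ρ S) (e : E) (X : Finset E) :
    marginal ρ e X ≤ 1 :=
  (div_le_one (add_pos (hρ _) (hρ _))).2 (by linarith [hρ (X.erase e)])

/-- The Markov operator that resamples `e`, given the rest, with probability `a S` of presence. -/
def resample (a : Finset E → ℝ) (e : E) (f : Finset E → ℝ) (S : Finset E) : ℝ :=
  a S * f (insert e S) + (1 - a S) * f (S.erase e)

/-- Stationarity of the heat bath: on each pair S, S ∪ {e} with e ∉ S, `marginal` is the conditional
probability of presence. -/
lemma sum_mul_resample_marginal {ρ : Finset E → ℝ} (hρ : ∀ S, 0 < ρ S) (e : E)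
    (f : Finset E → ℝ) : ∑ S, ρ S * resample (marginal ρ e) e f S = ∑ S, ρ S * f S := by
  rw [sum_univ_eq_sum_toggle e, sum_univ_eq_sum_toggle e]
  refine Finset.sum_congr rfl fun S hS => ?_
  have he : e ∉ S := fun h => by simpa using (Finset.mem_powerset.1 hS) h
  have h1 : S.erase e = S := Finset.erase_eq_of_notMem he
  have h2 : (insert e S).erase e = S := Finset.erase_insert he
  simp only [resample, marginal_insert, Finset.insert_idem, h1, h2]
  have h3 : ρ (insert e S) + ρ S ≠ 0 := (add_pos (hρ _) (hρ _)).ne'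
  simp only [marginal, h1]
  field_simp
  ring

lemma antitone_resample_const {l : ℝ} (h0 : 0 ≤ l) (h1 : l ≤ 1) (e : E) {f : Finset E → ℝ}
    (hf : Antitone f) : Antitone (resample (fun _ => l) e f) := by
  intro S S' h
  have h2 := hf (Finset.insert_subset_insert e h)
  have h3 := hf (Finset.erase_subset_erase e h)
  have := mul_le_mul_of_nonneg_left h2 h0
  have := mul_le_mul_of_nonneg_left h3 (sub_nonneg.2 h1)
  simp only [resample]
  linarith

lemma resample_le_resample_const {a : Finset E → ℝ} {l : ℝ} (e : E) {f : Finset E → ℝ}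
    (hf : Antitone f) (S : Finset E) (hl : l ≤ a S) :
    resample a e f S ≤ resample (fun _ => l) e f S := by
  have h := hf ((Finset.erase_subset e S).trans (Finset.subset_insert e S))
  have := mul_nonneg (sub_nonneg.2 hl) (sub_nonneg.2 h)
  simp only [resample]
  linarith

lemma prodLaw_pos {r : E → ℝ} (h0 : ∀ e, 0 < r e) (h1 : ∀ e, r e < 1) (S : Finset E) :
    0 < prodLaw r S :=
  mul_pos (Finset.prod_pos fun e _ => h0 e) (Finset.prod_pos fun e _ => sub_pos.2 (h1 e))

lemma sum_prod_mul_prod_compl (f g : E → ℝ) :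
    ∑ S : Finset E, (∏ e ∈ S, f e) * ∏ e ∈ Finset.univ \ S, g e = ∏ e, (f e + g e) := by
  rw [Finset.prod_add, Finset.powerset_univ]

lemma sum_prodLaw (r : E → ℝ) : ∑ S, prodLaw r S = 1 := by
  simp only [prodLaw, sum_prod_mul_prod_compl]
  simp

lemma marginal_prodLaw {r : E → ℝ} (h0 : ∀ e, 0 < r e) (h1 : ∀ e, r e < 1) (e : E)
    (X : Finset E) : marginal (prodLaw r) e X = r e := by
  have hi : prodLaw r (insert e X) =
      r e * ((∏ x ∈ X.erase e, r x) * ∏ x ∈ Finset.univ \ insert e X, (1 - r x)) := by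
    have h : insert e X = insert e (X.erase e) := by
      ext x; by_cases hx : x = e <;> simp [hx]
    rw [prodLaw, ← mul_assoc]
    conv_lhs => rw [h, Finset.prod_insert (by simp), ← h]
  have hc : Finset.univ \ X.erase e = insert e (Finset.univ \ insert e X) := by
    ext x; by_cases hx : x = e <;> simp [hx]
  have he : prodLaw r (X.erase e) =
      (1 - r e) * ((∏ x ∈ X.erase e, r x) * ∏ x ∈ Finset.univ \ insert e X, (1 - r x)) := by
    rw [prodLaw, hc, Finset.prod_insert (by simp)]; ring
  have hp := prodLaw_pos h0 h1 (insert e X)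
  rw [hi] at hp
  have hne := (pos_of_mul_pos_right hp (h0 e).le).ne'
  rw [marginal, hi, he, ← add_mul, mul_div_mul_right _ _ hne]
  simp

/-- A law whose conditional probabilities of presence are at least `l` gives antitone functions a
mean at most that under the product law with parameter `l`. -/
lemma sum_mul_le_sum_prodLaw {ρ : Finset E → ℝ} (hρ : ∀ S, 0 < ρ S) (hsum : ∑ S, ρ S = 1)
    {l : ℝ} (h0 : 0 ≤ l) (h1 : l ≤ 1) (hl : ∀ e X, l ≤ marginal ρ e X) {f : Finset E → ℝ}
    (hf : Antitone f) : ∑ S, ρ S * f S ≤ ∑ S, prodLaw (fun _ : E => l) S * f S := by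
  -- `B s` averages `f` after the sites of `s` are replaced by independent ones of parameter `l`;
  -- for `s = univ` it is constant. As `s` grows by one site, heat-bath resampling preserves the
  -- mean under `ρ`, and lowering its probability to `l` can only raise the mean of an antitone
  -- function.
  let B : Finset E → (Finset E → ℝ) := fun s S =>
    ∑ T ∈ s.powerset, (∏ _e ∈ T, l) * (∏ _e ∈ s \ T, (1 - l)) * f (S \ s ∪ T)
  have hstep : ∀ s e, e ∉ s → B (insert e s) = resample (fun _ => l) e (B s) := by
    intro s e he
    funext S
    simp only [B, resample]
    rw [Finset.sum_powerset_insert he, Finset.mul_sum, Finset.mul_sum, add_comm]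
    congr 1
    · refine Finset.sum_congr rfl fun T hT => ?_
      have hT := Finset.mem_powerset.1 hT
      have heT : e ∉ T := fun h => he (hT h)
      have e1 : insert e s \ insert e T = s \ T := by
        ext x; by_cases hx : x = e <;> simp [hx, he]
      have e2 : S \ insert e s ∪ insert e T = insert e S \ s ∪ T := by
        ext x; by_cases hx : x = e <;> simp [hx, he]
      rw [Finset.prod_insert heT, e1, e2]
      ring
    · refine Finset.sum_congr rfl fun T hT => ?_
      have hT := Finset.mem_powerset.1 hT
      have heT : e ∉ T := fun h => he (hT h)
      have e1 : insert e s \ T = insert e (s \ T) := by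
        ext x; by_cases hx : x = e <;> simp [hx, heT]
      have e2 : S \ insert e s ∪ T = S.erase e \ s ∪ T := by
        ext x; by_cases hx : x = e <;> simp [hx, heT]
      rw [e1, Finset.prod_insert (by simp [he]), e2]
      ring
  have hB : ∀ s, Antitone (B s) ∧ ∑ S, ρ S * f S ≤ ∑ S, ρ S * B s S := by
    intro s
    induction s using Finset.induction_on with
    | empty => simp [B]; exact fun a b h => by simpa using hf h
    | insert e s he ih =>
      rw [hstep s e he]
      refine ⟨antitone_resample_const h0 h1 e ih.1, ih.2.trans ?_⟩
      rw [← sum_mul_resample_marginal hρ e]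
      exact Finset.sum_le_sum fun S _ => mul_le_mul_of_nonneg_left
        (resample_le_resample_const e ih.1 S (hl e S)) (hρ S).le
  refine (hB Finset.univ).2.trans (le_of_eq ?_)
  have : ∀ S, B Finset.univ S = ∑ T, prodLaw (fun _ : E => l) T * f T := by
    intro S
    have h : S \ Finset.univ = ∅ := by ext; simp
    simp [B, prodLaw, h]
  simp only [this]
  rw [← Finset.sum_mul, hsum, one_mul]

end HeatBath

/-! ### Convergence of the sampler under a contraction hypothesis -/

section Convergence

variable {E : Type*} [Fintype E] [DecidableEq E]

lemma integral_threshold {a : ℝ} (h0 : 0 ≤ a) (h1 : a ≤ 1) (F : Bool → ℝ) :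
    ∫ r : unitInterval, F (decide ((r : ℝ) < a)) = a * F true + (1 - a) * F false := by
  have hms : MeasurableSet {r : unitInterval | (r : ℝ) < a} :=
    measurableSet_lt measurable_subtype_coe measurable_const
  have hF : ∀ r : unitInterval, F (decide ((r : ℝ) < a)) =
      {r : unitInterval | (r : ℝ) < a}.indicator (fun _ => F true - F false) r + F false := by
    intro r
    by_cases h : (r : ℝ) < a <;> simp [h]
  have hv : (volume : Measure unitInterval).real {r : unitInterval | (r : ℝ) < a} = a := by
    have : {r : unitInterval | (r : ℝ) < a} = Set.Iio ⟨a, h0, h1⟩ := rfl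
    rw [Measure.real, this, unitInterval.volume_Iio, ENNReal.toReal_ofReal h0]
  simp only [hF]
  rw [integral_add (((integrable_const _).indicator hms)) (integrable_const _),
    integral_indicator_const _ hms, hv]
  simp
  ring

/-- Two bits driven by the same threshold differ exactly when it falls between their parameters. -/
lemma integral_abs_threshold_sub {a b : ℝ} (ha0 : 0 ≤ a) (ha1 : a ≤ 1) (hb0 : 0 ≤ b)
    (hb1 : b ≤ 1) :
    ∫ r : unitInterval, (if decide ((r : ℝ) < a) = decide ((r : ℝ) < b) then (0 : ℝ) else 1) =
      |a - b| := by
  wlog hab : a ≤ b generalizing a b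
  · rw [abs_sub_comm, ← this hb0 hb1 ha0 ha1 (le_of_not_ge hab)]
    simp only [eq_comm]
  have h : ∀ r : unitInterval,
      (if decide ((r : ℝ) < a) = decide ((r : ℝ) < b) then (0 : ℝ) else 1) =
        (if decide ((r : ℝ) < b) then (1 : ℝ) else 0) -
          (if decide ((r : ℝ) < a) then (1 : ℝ) else 0) := by
    intro r
    by_cases h1 : (r : ℝ) < a
    · simp [h1, h1.trans_le hab]
    · by_cases h2 : (r : ℝ) < b <;> simp [h1, h2]
  simp only [h]
  have hint : ∀ c : ℝ, Integrable (fun r : unitInterval =>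
      if decide ((r : ℝ) < c) then (1 : ℝ) else 0) volume := fun c =>
    integrable_comp_of_finite volume (measurable_decide_lt c) fun b => if b then (1 : ℝ) else 0
  rw [integral_sub (hint b) (hint a), integral_threshold hb0 hb1 fun b => if b then 1 else 0,
    integral_threshold ha0 ha1 fun b => if b then 1 else 0, abs_sub_comm, abs_of_nonneg (by linarith)]
  simp

variable [Nonempty E] [MeasurableSpace E] [DiscreteMeasurableSpace E]

lemma stepOp_chainStep (μ : Finset E → ℝ) (N : ℕ) (F : ChainState E N → ℝ)
    (s : ChainState E N) :
    stepOp (updateLaw E) (chainStep μ N) F s =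
      (Fintype.card E : ℝ)⁻¹ * ∑ e, ∫ r : unitInterval, F (chainStep μ N (e, r) s) := by
  unfold stepOp updateLaw
  rw [integral_prod _ (integrable_comp_of_finite _ (measurable_chainStep μ N s) F),
    PMF.integral_eq_sum, Finset.mul_sum]
  simp

lemma resample_eq_setBit (a : Finset E → ℝ) (e : E) (f : Finset E → ℝ) (S : Finset E) :
    resample a e f S = a S * f (setBit e true S) + (1 - a S) * f (setBit e false S) := rfl

/-! ### Discrepancy between the rounds and the stationary dynamics. -/

section

variable {ρ : Finset E → ℝ} (hρ : ∀ S, 0 < ρ S) (N : ℕ)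
include hρ

lemma stepOp_comp_base (φ : Finset E → ℝ) :
    stepOp (updateLaw E) (chainStep ρ N) (fun s => φ s.base) = fun s =>
      (Fintype.card E : ℝ)⁻¹ * ∑ e, resample (marginal ρ e) e φ s.base := by
  funext s
  rw [stepOp_chainStep]
  congr 1
  refine Finset.sum_congr rfl fun e _ => ?_
  rw [resample_eq_setBit, ← integral_threshold (marginal_nonneg hρ e _) (marginal_le_one hρ e _)
    fun b => φ (setBit e b s.base)]
  rfl

lemma stepOp_comp_round_zero (φ : Finset E → ℝ) :
    stepOp (updateLaw E) (chainStep ρ N) (fun s => φ (s.round 0)) = fun s => φ (s.round 0) := by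
  funext s
  simp [stepOp, chainStep]

lemma stepOp_comp_round_succ (φ : Finset E → ℝ) (t : Fin N) :
    stepOp (updateLaw E) (chainStep ρ N) (fun s => φ (s.round t.succ)) = fun s =>
      (Fintype.card E : ℝ)⁻¹ * ∑ e, resample (fun _ => marginal ρ e (s.round t.castSucc)) e φ
        (s.round t.succ) := by
  funext s
  rw [stepOp_chainStep]
  congr 1
  refine Finset.sum_congr rfl fun e _ => ?_
  rw [resample_eq_setBit, ← integral_threshold (marginal_nonneg hρ e _) (marginal_le_one hρ e _)
    fun b => φ (setBit e b (s.round t.succ))]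
  rfl

/-- The number of sites at which round `t` differs from the sequential dynamics. -/
def discrepancy (N : ℕ) (t : Fin (N + 1)) (s : ChainState E N) : ℝ :=
  ((symmDiff (s.round t) s.base).card : ℝ)

omit hρ in
lemma card_symmDiff_setBit (e : E) (b c : Bool) (S W : Finset E) :
    ((symmDiff (setBit e b S) (setBit e c W)).card : ℝ) =
      ((symmDiff S W).card : ℝ) - (if e ∈ symmDiff S W then 1 else 0) +
        (if b = c then 0 else 1) := by
  have h1 : (((symmDiff S W).erase e).card : ℝ) =
      ((symmDiff S W).card : ℝ) - (if e ∈ symmDiff S W then 1 else 0) := by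
    split_ifs with h
    · rw [← Finset.card_erase_add_one h]; push_cast; ring
    · rw [Finset.erase_eq_of_notMem h, sub_zero]
  rw [← h1]
  split_ifs with h
  · have : symmDiff (setBit e b S) (setBit e c W) = (symmDiff S W).erase e := by
      subst h
      ext x
      by_cases hx : x = e <;> cases b <;> simp [setBit, Finset.mem_symmDiff, hx]
    rw [this, add_zero]
  · have : symmDiff (setBit e b S) (setBit e c W) = insert e ((symmDiff S W).erase e) := by
      ext x
      by_cases hx : x = e <;> cases b <;> cases c <;>
        simp_all [setBit, Finset.mem_symmDiff]
    rw [this, Finset.card_insert_of_notMem (Finset.notMem_erase e _)]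
    push_cast
    ring

lemma stepOp_discrepancy (t : Fin N) (s : ChainState E N) :
    stepOp (updateLaw E) (chainStep ρ N) (discrepancy N t.succ) s =
      (1 - (Fintype.card E : ℝ)⁻¹) * discrepancy N t.succ s + (Fintype.card E : ℝ)⁻¹ *
        ∑ e, |marginal ρ e (s.round t.castSucc) - marginal ρ e s.base| := by
  have hm : (Fintype.card E : ℝ) ≠ 0 := Nat.cast_ne_zero.2 Fintype.card_ne_zero
  have h : ∀ e, ∫ r : unitInterval, discrepancy N t.succ (chainStep ρ N (e, r) s) =
      discrepancy N t.succ s - (if e ∈ symmDiff (s.round t.succ) s.base then 1 else 0) +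
        |marginal ρ e (s.round t.castSucc) - marginal ρ e s.base| := by
    intro e
    rw [← integral_abs_threshold_sub (marginal_nonneg hρ e _) (marginal_le_one hρ e _)
      (marginal_nonneg hρ e _) (marginal_le_one hρ e _)]
    have hint : Integrable (fun r : unitInterval =>
        if decide ((r : ℝ) < marginal ρ e (s.round t.castSucc)) =
          decide ((r : ℝ) < marginal ρ e s.base) then (0 : ℝ) else 1) volume :=
      integrable_comp_of_finite volume ((measurable_decide_lt _).prodMk (measurable_decide_lt _))
        fun b : Bool × Bool => if b.1 = b.2 then (0 : ℝ) else 1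
    have : ∀ r : unitInterval, discrepancy N t.succ (chainStep ρ N (e, r) s) =
        (discrepancy N t.succ s - (if e ∈ symmDiff (s.round t.succ) s.base then 1 else 0)) +
        (if decide ((r : ℝ) < marginal ρ e (s.round t.castSucc)) =
          decide ((r : ℝ) < marginal ρ e s.base) then (0 : ℝ) else 1) := fun r =>
      card_symmDiff_setBit e _ _ _ _
    simp only [this]
    rw [integral_add (integrable_const _) hint]
    simp
  rw [stepOp_chainStep]
  simp only [h]
  rw [Finset.sum_add_distrib, Finset.sum_sub_distrib]
  simp only [Finset.sum_const, Finset.card_univ, nsmul_eq_mul, Finset.sum_ite_mem,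
    Finset.univ_inter, mul_one]
  unfold discrepancy
  field_simp

/-- Expectation after `i` updates, when the sequential dynamics starts from the law `ρ` and the
rounds start from the law `ν`. -/
def chainExpect (ρ ν : Finset E → ℝ) (N i : ℕ) : (ChainState E N → ℝ) →ₗ[ℝ] ℝ where
  toFun F := ∑ W, ∑ X, ρ W * ν X * (stepOp (updateLaw E) (chainStep ρ N))^[i] F ⟨W, fun _ => X⟩
  map_add' F F' := by
    have := iterate_stepOp_linear (updateLaw E) (measurable_chainStep ρ N) i 1 1 F F'
    simp only [one_mul] at this
    have h : F + F' = fun s => F s + F' s := rfl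
    rw [h, this]
    simp only [mul_add, Finset.sum_add_distrib]
  map_smul' c F := by
    have := iterate_stepOp_linear (updateLaw E) (measurable_chainStep ρ N) i c 0 F F
    simp only [zero_mul, add_zero] at this
    have h : c • F = fun s => c * F s := rfl
    rw [h, this]
    simp only [RingHom.id_apply, smul_eq_mul, Finset.mul_sum]
    exact Finset.sum_congr rfl fun _ _ => Finset.sum_congr rfl fun _ _ => by ring

omit hρ in
lemma chainExpect_apply (ν : Finset E → ℝ) (i : ℕ) (F : ChainState E N → ℝ) :
    chainExpect ρ ν N i F = ∑ W, ∑ X, ρ W * ν X *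
      (stepOp (updateLaw E) (chainStep ρ N))^[i] F ⟨W, fun _ => X⟩ := rfl

-- The added operator is the innermost one, so this splits off the last update.
omit hρ in
lemma chainExpect_succ (ν : Finset E → ℝ) (i : ℕ) (F : ChainState E N → ℝ) :
    chainExpect ρ ν N (i + 1) F =
      chainExpect ρ ν N i (stepOp (updateLaw E) (chainStep ρ N) F) := rfl

variable {ν : Finset E → ℝ} (hν : ∀ S, 0 < ν S)
include hν

lemma chainExpect_mono (i : ℕ) {F F' : ChainState E N → ℝ} (h : ∀ s, F s ≤ F' s) :
    chainExpect ρ ν N i F ≤ chainExpect ρ ν N i F' :=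
  Finset.sum_le_sum fun W _ => Finset.sum_le_sum fun X _ => mul_le_mul_of_nonneg_left
    (iterate_stepOp_mono _ (measurable_chainStep ρ N) i h _) (mul_pos (hρ W) (hν X)).le

variable (hνs : ∑ S, ν S = 1)
include hνs

omit hν in
lemma chainExpect_comp_base (i : ℕ) (φ : Finset E → ℝ) :
    chainExpect ρ ν N i (fun s => φ s.base) = ∑ S, ρ S * φ S := by
  induction i generalizing φ with
  | zero =>
    rw [chainExpect_apply]
    refine Finset.sum_congr rfl fun W _ => ?_
    simp only [Function.iterate_zero, id]
    rw [← Finset.sum_mul, ← Finset.mul_sum, hνs, mul_one]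
  | succ i ih =>
    rw [chainExpect_succ, stepOp_comp_base hρ,
      ih fun S => (Fintype.card E : ℝ)⁻¹ * ∑ e, resample (marginal ρ e) e φ S]
    simp only [mul_left_comm (ρ _), Finset.mul_sum]
    rw [Finset.sum_comm]
    simp only [← Finset.mul_sum, sum_mul_resample_marginal hρ]
    have hm : (Fintype.card E : ℝ) ≠ 0 := Nat.cast_ne_zero.2 Fintype.card_ne_zero
    simp [hm]

variable (hρs : ∑ S, ρ S = 1)
include hρs

/-- Whatever the previous round shows, the chosen site becomes present with probability at least
`l`. Replacing that probability by `l` gives an update that keeps `f` antitone and leaves the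
product law stationary, so domination passes from each time to the next. -/
lemma chainExpect_comp_round_le {l : ℝ} (h0 : 0 < l) (h1 : l < 1)
    (hρl : ∀ e X, l ≤ marginal ρ e X) (hνl : ∀ e X, l ≤ marginal ν e X)
    {f : Finset E → ℝ} (hf : Antitone f) (t : Fin (N + 1)) (i : ℕ) :
    chainExpect ρ ν N i (fun s => f (s.round t)) ≤ ∑ S, prodLaw (fun _ : E => l) S * f S := by
  have hm : (0 : ℝ) < Fintype.card E := Nat.cast_pos.2 Fintype.card_pos
  induction i generalizing f with
  | zero =>
    refine le_trans (le_of_eq ?_) (sum_mul_le_sum_prodLaw hν hνs h0.le h1.le hνl hf)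
    rw [chainExpect_apply]
    simp only [Function.iterate_zero, id]
    rw [Finset.sum_comm]
    refine Finset.sum_congr rfl fun X _ => ?_
    simp only [← Finset.sum_mul, hρs, one_mul]
  | succ i ih =>
    rw [chainExpect_succ]
    induction t using Fin.cases with
    | zero => rw [stepOp_comp_round_zero hρ]; exact ih hf
    | succ t =>
      rw [stepOp_comp_round_succ hρ]
      let g : Finset E → ℝ := fun S =>
        (Fintype.card E : ℝ)⁻¹ * ∑ e, resample (fun _ => l) e f S
      have hg : Antitone g := fun S S' h => mul_le_mul_of_nonneg_left
        (Finset.sum_le_sum fun e _ => antitone_resample_const h0.le h1.le e hf h)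
        (inv_nonneg.2 hm.le)
      refine (chainExpect_mono hρ N hν i (F' := fun s => g (s.round t.succ)) fun s => ?_).trans
        ((ih hg).trans (le_of_eq ?_))
      · exact mul_le_mul_of_nonneg_left (Finset.sum_le_sum fun e _ =>
          resample_le_resample_const e hf _ (hρl e _)) (inv_nonneg.2 hm.le)
      · simp only [g, mul_left_comm (prodLaw _ _), Finset.mul_sum]
        rw [Finset.sum_comm]
        simp only [← Finset.mul_sum]
        have : ∀ e, ∑ S, prodLaw (fun _ : E => l) S * resample (fun _ => l) e f S =
            ∑ S, prodLaw (fun _ : E => l) S * f S := by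
          intro e
          have h := sum_mul_resample_marginal (prodLaw_pos (r := fun _ : E => l) (fun _ => h0)
            fun _ => h1) e f
          have h' : marginal (prodLaw fun _ : E => l) e = fun _ => l :=
            funext fun X => marginal_prodLaw (fun _ => h0) (fun _ => h1) e X
          rwa [h'] at h
        simp only [this]
        simp [hm.ne']

/-- The bound solves D_{i+1}^{t+1} = (1 − 1/m) D_i^{t+1} + D_i^t/(2m) + 2β exactly, where 2β bounds
the means of `f` at the round and at the base. For i = 0 or t = 0 the trivial bound m suffices. -/
lemma chainExpect_discrepancy_le {l β : ℝ} (h0 : 0 < l) (h1 : l < 1)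
    (hρl : ∀ e X, l ≤ marginal ρ e X) (hνl : ∀ e X, l ≤ marginal ν e X)
    {f : Finset E → ℝ} (hf : Antitone f) (hβ : ∑ S, prodLaw (fun _ : E => l) S * f S ≤ β)
    (hcontr : ∀ S W, ∑ e, |marginal ρ e S - marginal ρ e W| ≤
      1 / 2 * ((symmDiff S W).card : ℝ) + Fintype.card E * (f S + f W))
    (hβ0 : 0 ≤ β) (i : ℕ) (t : Fin (N + 1)) :
    chainExpect ρ ν N i (discrepancy N t) ≤
      Fintype.card E * ((1 - (2 * Fintype.card E : ℝ)⁻¹) ^ i + (1 / 2) ^ (t : ℕ)) +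
        4 * Fintype.card E * β := by
  set m : ℝ := (Fintype.card E : ℝ) with hmdef
  have hm : (1 : ℝ) ≤ m := Nat.one_le_cast.2 Fintype.card_pos
  have hθ : 0 ≤ 1 - (2 * m)⁻¹ := by
    rw [sub_nonneg]; exact inv_le_one_of_one_le₀ (by linarith)
  have hD : ∀ j, chainExpect ρ ν N j (fun _ => m) = m := fun j => by
    rw [chainExpect_comp_base hρ N hνs j fun _ => m, ← Finset.sum_mul, hρs, one_mul]
  have htriv : ∀ j t, chainExpect ρ ν N j (discrepancy N t) ≤ m := fun j t => by
    refine (chainExpect_mono hρ N hν j (F' := fun _ => m) fun s => ?_).trans_eq (hD j)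
    exact Nat.cast_le.2 (Finset.card_le_univ _)
  have hrest : 0 ≤ 4 * m * β := by positivity
  induction i generalizing t with
  | zero =>
    have : 0 ≤ m * (1 / 2 : ℝ) ^ (t : ℕ) := by positivity
    have := htriv 0 t
    rw [pow_zero]
    linarith
  | succ i ih =>
    induction t using Fin.cases with
    | zero =>
      have : 0 ≤ m * (1 - (2 * m)⁻¹) ^ (i + 1) := by positivity
      have := htriv (i + 1) 0
      rw [Fin.val_zero, pow_zero]
      linarith
    | succ t =>
      have hminv : 0 ≤ m⁻¹ := by positivity
      have hm1 : 0 ≤ 1 - m⁻¹ := sub_nonneg.2 (inv_le_one_of_one_le₀ hm)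
      let F' : ChainState E N → ℝ := (1 - m⁻¹) • discrepancy N t.succ +
        (m⁻¹ / 2) • discrepancy N t.castSucc + (fun s => f (s.round t.castSucc)) +
        fun s => f s.base
      have hF' : ∀ s, stepOp (updateLaw E) (chainStep ρ N) (discrepancy N t.succ) s ≤ F' s := by
        intro s
        rw [stepOp_discrepancy hρ]
        have h := mul_le_mul_of_nonneg_left (hcontr (s.round t.castSucc) s.base) hminv
        have hmm : m⁻¹ * (m * (f (s.round t.castSucc) + f s.base)) =
            f (s.round t.castSucc) + f s.base := by
          rw [← mul_assoc, inv_mul_cancel₀ (by linarith), one_mul]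
        rw [← hmdef]
        simp only [F', Pi.add_apply, Pi.smul_apply, smul_eq_mul]
        have hd : discrepancy N t.castSucc s =
          ((symmDiff (s.round t.castSucc) s.base).card : ℝ) := rfl
        rw [mul_add, hmm, ← hd] at h
        linarith
      have h2 := chainExpect_mono hρ N hν i hF'
      rw [← chainExpect_succ] at h2
      simp only [F', map_add, map_smul, smul_eq_mul] at h2
      have h3 := mul_le_mul_of_nonneg_left (ih t.succ) hm1
      have h4 := mul_le_mul_of_nonneg_left (ih t.castSucc) (by positivity : 0 ≤ m⁻¹ / 2)
      have h5 := (chainExpect_comp_round_le hρ N hν hνs hρs h0 h1 hρl hνl hf t.castSucc i).trans hβ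
      have h6 := (sum_mul_le_sum_prodLaw hρ hρs h0.le h1.le hρl hf).trans hβ
      rw [← chainExpect_comp_base hρ N hνs i] at h6
      refine (h2.trans (add_le_add (add_le_add (add_le_add h3 h4) h5) h6)).trans (le_of_eq ?_)
      simp only [Fin.val_succ, Fin.val_castSucc, pow_succ]
      field_simp
      ring

end

/-- Total variation bound for the sampler. The function `f` plays the role of the indicator of
a decreasing event off which the heat-bath probabilities are a contraction. -/
theorem tvDist_outputProb_le {ρ : Finset E → ℝ} (hρ : ∀ S, 0 < ρ S) (hρs : ∑ S, ρ S = 1)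
    {l β : ℝ} (h0 : 0 < l) (h1 : l < 1) (hρl : ∀ e X, l ≤ marginal ρ e X)
    {f : Finset E → ℝ} (hf : Antitone f) (hβ0 : 0 ≤ β)
    (hβ : ∑ S, prodLaw (fun _ : E => l) S * f S ≤ β)
    (hcontr : ∀ S W, ∑ e, |marginal ρ e S - marginal ρ e W| ≤
      1 / 2 * ((symmDiff S W).card : ℝ) + Fintype.card E * (f S + f W)) (T N : ℕ) :
    tvDist (outputProb ρ T N) ρ ≤
      Fintype.card E * ((1 - (2 * Fintype.card E : ℝ)⁻¹) ^ T + (1 / 2) ^ N) +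
        4 * Fintype.card E * β := by
  classical
  set r : E → ℝ := fun e => marginal ρ e Finset.univ with hr
  have hr0 : ∀ e, 0 < r e := fun e => h0.trans_le (hρl e _)
  have hr1 : ∀ e, r e < 1 := fun e =>
    (div_lt_one (add_pos (hρ _) (hρ _))).2 (by linarith [hρ (Finset.univ.erase e)])
  set ν := prodLaw r with hν
  have hνp : ∀ S, 0 < ν S := prodLaw_pos hr0 hr1
  have hνs : ∑ S, ν S = 1 := sum_prodLaw r
  have hνl : ∀ e X, l ≤ marginal ν e X := fun e X => by
    rw [marginal_prodLaw hr0 hr1]; exact hρl e _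
  have hout : ∀ S, outputProb ρ T N S =
      chainExpect ρ ν N T fun s => if s.round (Fin.last N) = S then 1 else 0 := by
    intro S
    rw [chainExpect_apply]
    have h : ∀ W, ρ W * outputProb ρ T N S = ∑ X, ρ W * ν X *
        (stepOp (updateLaw E) (chainStep ρ N))^[T]
          (fun s => if s.round (Fin.last N) = S then 1 else 0) ⟨W, fun _ => X⟩ := by
      intro W
      rw [outputProb_eq ρ (fun e => (hr0 e).le) (fun e => (hr1 e).le) T N S W, Finset.mul_sum]
      exact Finset.sum_congr rfl fun X _ => by rw [mul_assoc]
    rw [← Finset.sum_congr rfl fun W _ => h W, ← Finset.sum_mul, hρs, one_mul]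
  have hbase : ∀ S, ρ S = chainExpect ρ ν N T fun s => if s.base = S then 1 else 0 := by
    intro S
    rw [chainExpect_comp_base hρ N hνs T fun X => if X = S then 1 else 0]
    simp
  have habs : ∀ F : ChainState E N → ℝ,
      |chainExpect ρ ν N T F| ≤ chainExpect ρ ν N T fun s => |F s| := by
    intro F
    refine abs_le.2 ⟨?_, chainExpect_mono hρ N hνp T fun s => le_abs_self _⟩
    rw [← map_neg]
    exact chainExpect_mono hρ N hνp T fun s => neg_abs_le _
  refine le_trans ?_ (chainExpect_discrepancy_le hρ N hνp hνs hρs h0 h1 hρl hνl hf hβ hcontr hβ0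
    T (Fin.last N))
  have hsum : ∑ S, |outputProb ρ T N S - ρ S| ≤
      chainExpect ρ ν N T ((2 : ℝ) • discrepancy N (Fin.last N)) := by
    calc ∑ S, |outputProb ρ T N S - ρ S| ≤ ∑ S, chainExpect ρ ν N T fun s =>
          |(if s.round (Fin.last N) = S then (1 : ℝ) else 0) - if s.base = S then 1 else 0| := by
          refine Finset.sum_le_sum fun S _ => ?_
          conv_lhs => rw [hout S, hbase S, ← map_sub]
          exact habs _
      _ ≤ _ := by
          rw [← map_sum]
          refine chainExpect_mono hρ N hνp T fun s => ?_
          simp only [Finset.sum_apply, Pi.smul_apply, smul_eq_mul]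
          -- Point masses at distinct configurations are at ℓ¹ distance 2, and distinct
          -- configurations differ at one site at least.
          by_cases h : s.round (Fin.last N) = s.base
          · simp [h, discrepancy]
          · have h1 : (1 : ℝ) ≤ discrepancy N (Fin.last N) s := by
              refine Nat.one_le_cast.2 (Finset.card_pos.2 (Finset.nonempty_iff_ne_empty.2 ?_))
              exact fun h' => h (symmDiff_eq_bot.1 h')
            calc _ ≤ ∑ S, ((if s.round (Fin.last N) = S then (1 : ℝ) else 0) +
                  if s.base = S then 1 else 0) := by
                  refine Finset.sum_le_sum fun S _ => ?_
                  split_ifs <;> norm_num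
              _ = 2 := by rw [Finset.sum_add_distrib]; simp; norm_num
              _ ≤ _ := by linarith
  rw [map_smul, smul_eq_mul] at hsum
  unfold tvDist
  linarith

end Convergence

/-! ### Connected components of spanning subgraphs -/

section Components

variable {V : Type*} [Fintype V] [DecidableEq V] {G : SimpleGraph V} [DecidableRel G.Adj]

open Classical in
/-- The vertex set of the connected component of `w` in `(V, S)`. -/
def comp (S : Finset G.edgeSet) (w : V) : Finset V :=
  Finset.univ.filter fun x => (spanning G S).Reachable w x

/-- The edges of `G` that leave `U`. -/
def bdry (G : SimpleGraph V) [DecidableRel G.Adj] (U : Finset V) : Finset G.edgeSet :=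
  Finset.univ.filter fun e => ∃ a ∈ U, ∃ b ∉ U, (e : Sym2 V) = s(a, b)

lemma mem_comp {S : Finset G.edgeSet} {w x : V} :
    x ∈ comp S w ↔ (spanning G S).Reachable w x := by
  simp [comp]

lemma mem_bdry {U : Finset V} {e : G.edgeSet} :
    e ∈ bdry G U ↔ ∃ a ∈ U, ∃ b ∉ U, (e : Sym2 V) = s(a, b) := by
  simp [bdry]

lemma mem_comp_self (S : Finset G.edgeSet) (w : V) : w ∈ comp S w :=
  mem_comp.2 (SimpleGraph.Reachable.refl w)

lemma exists_eq_mk (e : G.edgeSet) : ∃ a b, (e : Sym2 V) = s(a, b) := by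
  obtain ⟨e, he⟩ := e
  induction e using Sym2.ind with
  | _ a b => exact ⟨a, b, rfl⟩

lemma spanning_adj {S : Finset G.edgeSet} {a b : V} :
    (spanning G S).Adj a b ↔ ∃ e ∈ S, (e : Sym2 V) = s(a, b) := by
  rw [spanning, SimpleGraph.fromEdgeSet_adj]
  constructor
  · rintro ⟨h, -⟩; exact h
  · rintro ⟨e, he, h⟩
    refine ⟨⟨e, he, h⟩, ?_⟩
    have : G.Adj a b := by rw [← SimpleGraph.mem_edgeSet, ← h]; exact e.2
    exact this.ne

lemma comp_eq_of_mem {S : Finset G.edgeSet} {w x : V} (h : x ∈ comp S w) :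
    comp S x = comp S w := by
  ext y
  rw [mem_comp] at *
  rw [mem_comp]
  exact ⟨fun h' => h.trans h', fun h' => h.symm.trans h'⟩

lemma mem_comp_comm {S : Finset G.edgeSet} {w x : V} : x ∈ comp S w ↔ w ∈ comp S x := by
  rw [mem_comp, mem_comp, SimpleGraph.reachable_comm]

lemma comp_closed {S : Finset G.edgeSet} {w a b : V} {e : G.edgeSet} (he : e ∈ S)
    (hab : (e : Sym2 V) = s(a, b)) (ha : a ∈ comp S w) : b ∈ comp S w := by
  rw [mem_comp] at *
  exact ha.trans (spanning_adj.2 ⟨e, he, hab⟩).reachable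

lemma comp_subset_of_closed {S : Finset G.edgeSet} {w : V} {U : Finset V} (hw : w ∈ U)
    (hU : ∀ e ∈ S, ∀ a b, (e : Sym2 V) = s(a, b) → a ∈ U → b ∈ U) : comp S w ⊆ U := by
  intro x hx
  rw [mem_comp] at hx
  obtain ⟨q⟩ := hx
  induction q with
  | nil => exact hw
  | cons h _ ih =>
    obtain ⟨e, he, hab⟩ := spanning_adj.1 h
    exact ih (hU e he _ _ hab hw)

/-- A path from `w` never leaves the component of `w`, so only the edges inside it matter. -/
lemma comp_subset_comp {S S' : Finset G.edgeSet} {w : V}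
    (h : ∀ e ∈ S, ∀ a b, (e : Sym2 V) = s(a, b) → a ∈ comp S w → b ∈ comp S w → e ∈ S') :
    comp S w ⊆ comp S' w := by
  have : comp S w ⊆ comp S w ∩ comp S' w := by
    refine comp_subset_of_closed (Finset.mem_inter.2 ⟨mem_comp_self _ _, mem_comp_self _ _⟩) ?_
    intro e he a b hab ha
    rw [Finset.mem_inter] at *
    have hb := comp_closed he hab ha.1
    exact ⟨hb, comp_closed (h e he a b hab ha.1 hb) hab ha.2⟩
  exact this.trans Finset.inter_subset_right

lemma comp_mono {S S' : Finset G.edgeSet} (h : S ⊆ S') (w : V) : comp S w ⊆ comp S' w :=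
  comp_subset_comp fun _ he _ _ _ _ _ => h he

lemma notMem_of_mem_bdry_comp {S : Finset G.edgeSet} {w : V} {e : G.edgeSet}
    (he : e ∈ bdry G (comp S w)) : e ∉ S := by
  obtain ⟨a, ha, b, hb, hab⟩ := mem_bdry.1 he
  exact fun h => hb (comp_closed h hab ha)

/-- An edge inside a component does not change the components. -/
lemma comp_insert_of_mem {S : Finset G.edgeSet} {f : G.edgeSet} {u v : V}
    (hf : (f : Sym2 V) = s(u, v)) (h : v ∈ comp S u) (x : V) :
    comp (insert f S) x = comp S x := by
  refine (comp_subset_of_closed (mem_comp_self S x) ?_).antisymm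
    (comp_mono (Finset.subset_insert f S) x)
  intro e he a b hab ha
  rcases Finset.mem_insert.1 he with rfl | he
  · have hb : b ∈ comp S a := by
      rw [hf, Sym2.eq_iff] at hab
      rcases hab with ⟨rfl, rfl⟩ | ⟨rfl, rfl⟩
      · exact h
      · exact mem_comp_comm.1 h
    rw [← comp_eq_of_mem ha]; exact hb
  · exact comp_closed he hab ha

/-- An edge between two components merges them and leaves the other ones unchanged. -/
lemma comp_insert {S : Finset G.edgeSet} {f : G.edgeSet} {u v : V}
    (hf : (f : Sym2 V) = s(u, v)) (x : V) :
    comp (insert f S) x =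
      if x ∈ comp S u ∪ comp S v then comp S u ∪ comp S v else comp S x := by
  have huv : v ∈ comp (insert f S) u :=
    comp_closed (Finset.mem_insert_self f S) hf (mem_comp_self _ _)
  have hmono := comp_mono (Finset.subset_insert f S)
  split_ifs with hx
  · have hsub : comp S u ∪ comp S v ⊆ comp (insert f S) u :=
      Finset.union_subset (hmono u) (by rw [← comp_eq_of_mem huv]; exact hmono v)
    rw [comp_eq_of_mem (hsub hx)]
    refine (comp_subset_of_closed (Finset.mem_union_left _ (mem_comp_self S u)) ?_).antisymm hsub
    intro e he a b hab ha
    rcases Finset.mem_insert.1 he with rfl | he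
    · rw [hf, Sym2.eq_iff] at hab
      rcases hab with ⟨rfl, rfl⟩ | ⟨rfl, rfl⟩
      · exact Finset.mem_union_right _ (mem_comp_self S _)
      · exact Finset.mem_union_left _ (mem_comp_self S _)
    · rcases Finset.mem_union.1 ha with ha | ha
      · exact Finset.mem_union_left _ (comp_closed he hab ha)
      · exact Finset.mem_union_right _ (comp_closed he hab ha)
  · refine (comp_subset_of_closed (mem_comp_self S x) ?_).antisymm (hmono x)
    intro e he a b hab ha
    rcases Finset.mem_insert.1 he with rfl | he
    · exfalso
      apply hx
      rw [hf, Sym2.eq_iff] at hab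
      rcases hab with ⟨rfl, rfl⟩ | ⟨rfl, rfl⟩
      · exact Finset.mem_union_left _ (mem_comp_comm.1 ha)
      · exact Finset.mem_union_right _ (mem_comp_comm.1 ha)
    · exact comp_closed he hab ha

/-- Every component has at most `L` boundary edges per vertex. -/
def SmallBoundary (L : ℝ) (S : Finset G.edgeSet) : Prop :=
  ∀ w, ((bdry G (comp S w)).card : ℝ) ≤ L * (comp S w).card

/-- A component of `S'` is a disjoint union of components of `S`, and its boundary lies in the union
of theirs. -/
lemma SmallBoundary.mono {L : ℝ} {S S' : Finset G.edgeSet} (hS : SmallBoundary L S)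
    (h : S ⊆ S') : SmallBoundary L S' := by
  intro w
  set C := comp S' w
  have hsub : ∀ a ∈ C, comp S a ⊆ C := fun a ha =>
    (comp_mono h a).trans (comp_eq_of_mem ha).le
  have h1 : bdry G C ⊆ (C.image (comp S)).biUnion (bdry G) := by
    intro e he
    obtain ⟨a, ha, b, hb, hab⟩ := mem_bdry.1 he
    exact Finset.mem_biUnion.2 ⟨comp S a, Finset.mem_image_of_mem _ ha,
      mem_bdry.2 ⟨a, mem_comp_self S a, b, fun hb' => hb (hsub a ha hb'), hab⟩⟩
  have h2 : C.card = ∑ U ∈ C.image (comp S), U.card := by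
    rw [Finset.card_eq_sum_card_image (comp S) C]
    refine Finset.sum_congr rfl fun U hU => ?_
    obtain ⟨a, ha, rfl⟩ := Finset.mem_image.1 hU
    congr 1
    ext x
    rw [Finset.mem_filter]
    constructor
    · rintro ⟨-, hx⟩; rw [← hx]; exact mem_comp_self S x
    · intro hx; exact ⟨hsub a ha hx, comp_eq_of_mem hx⟩
  have h3 : ((bdry G C).card : ℝ) ≤ ∑ U ∈ C.image (comp S), ((bdry G U).card : ℝ) := by
    exact_mod_cast (Finset.card_le_card h1).trans Finset.card_biUnion_le
  refine h3.trans ?_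
  rw [h2]
  push_cast
  rw [Finset.mul_sum]
  refine Finset.sum_le_sum fun U hU => ?_
  obtain ⟨a, -, rfl⟩ := Finset.mem_image.1 hU
  exact hS a

/-! ### Bridges -/

/-- At most `k` edges of `Z` cut off from the rest of `Z` a set of at most `k` vertices that
contains `w`. -/
lemma card_bridges_le (Z : Finset G.edgeSet) (w : V) (k : ℕ) :
    ((Z.filter fun e => e ∈ bdry G (comp (Z.erase e) w)).filter
      fun e => (comp (Z.erase e) w).card ≤ k).card ≤ k := by
  set F := (Z.filter fun e => e ∈ bdry G (comp (Z.erase e) w)).filter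
      fun e => (comp (Z.erase e) w).card ≤ k
  rcases F.eq_empty_or_nonempty with hF | hF
  · rw [hF]; simp
  -- `e₀` has the largest side around `w`. The far ends of the other edges are distinct and lie in
  -- this side, away from `w`, which gives |F| − 1 ≤ k − 1.
  obtain ⟨e₀, he₀, hmax⟩ := Finset.exists_max_image F (fun e => (comp (Z.erase e) w).card) hF
  have hF' : ∀ e ∈ F, e ∈ Z ∧ (∃ a ∈ comp (Z.erase e) w, ∃ b ∉ comp (Z.erase e) w,
      (e : Sym2 V) = s(a, b)) ∧ (comp (Z.erase e) w).card ≤ k := by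
    intro e he
    simp only [F, Finset.mem_filter] at he
    exact ⟨he.1.1, mem_bdry.1 he.1.2, he.2⟩
  have hends : ∀ e : G.edgeSet, ∃ a b : V, e ∈ F → a ∈ comp (Z.erase e) w ∧
      b ∉ comp (Z.erase e) w ∧ (e : Sym2 V) = s(a, b) := by
    intro e
    by_cases he : e ∈ F
    · obtain ⟨a, ha, b, hb, hab⟩ := (hF' e he).2.1
      exact ⟨a, b, fun _ => ⟨ha, hb, hab⟩⟩
    · exact ⟨w, w, fun h => absurd h he⟩
  choose near far hnf using hends
  have hmaps : ∀ e ∈ F.erase e₀, far e ∈ (comp (Z.erase e₀) w).erase w := by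
    intro e he
    obtain ⟨hne, he⟩ := Finset.mem_erase.1 he
    obtain ⟨h1, h2, h3⟩ := hnf e he
    obtain ⟨g1, g2, g3⟩ := hnf e₀ he₀
    refine Finset.mem_erase.2 ⟨fun h => h2 (h ▸ mem_comp_self _ _), ?_⟩
    -- Otherwise both ends of `e` lie outside the side of `e₀`, which thus survives the removal of
    -- `e`. The side of `e` then contains it and also `far e₀`, against maximality.
    by_contra hfar
    have hnear : near e ∉ comp (Z.erase e₀) w := fun h =>
      hfar (comp_closed (Finset.mem_erase.2 ⟨hne, (hF' e he).1⟩) h3 h)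
    have hsub : comp (Z.erase e₀) w ⊆ comp (Z.erase e) w := by
      refine comp_subset_comp fun x hx a b hab ha hb => ?_
      refine Finset.mem_erase.2 ⟨?_, (Finset.mem_erase.1 hx).2⟩
      rintro rfl
      rw [h3, Sym2.eq_iff] at hab
      rcases hab with ⟨rfl, rfl⟩ | ⟨rfl, rfl⟩
      · exact hnear ha
      · exact hfar ha
    have hmem : far e₀ ∈ comp (Z.erase e) w :=
      comp_closed (Finset.mem_erase.2 ⟨hne.symm, (hF' e₀ he₀).1⟩) g3 (hsub g1)
    have : (comp (Z.erase e₀) w).card < (comp (Z.erase e) w).card :=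
      Finset.card_lt_card ⟨hsub, fun h => g2 (h hmem)⟩
    exact absurd (hmax e he) (not_le.2 this)
  -- If `e` and `e'` share their far end, the side of `e` avoids `e'` and survives its removal; `e`
  -- then leads from it to the far end of `e'`.
  have hinj : Set.InjOn far (F.erase e₀ : Finset G.edgeSet) := by
    intro e he e' he' heq
    by_contra hne
    obtain ⟨h1, h2, h3⟩ := hnf e (Finset.mem_of_mem_erase he)
    obtain ⟨g1, g2, g3⟩ := hnf e' (Finset.mem_of_mem_erase he')
    have hsub : comp (Z.erase e) w ⊆ comp (Z.erase e') w := by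
      refine comp_subset_comp fun x hx a b hab ha hb => ?_
      refine Finset.mem_erase.2 ⟨?_, (Finset.mem_erase.1 hx).2⟩
      rintro rfl
      rw [g3, Sym2.eq_iff, ← heq] at hab
      rcases hab with ⟨rfl, rfl⟩ | ⟨rfl, rfl⟩
      · exact h2 hb
      · exact h2 ha
    apply g2
    rw [← heq]
    exact comp_closed (Finset.mem_erase.2 ⟨hne, (hF' e (Finset.mem_of_mem_erase he)).1⟩) h3
      (hsub h1)
  have hcard := Finset.card_le_card_of_injOn far hmaps hinj
  rw [Finset.card_erase_of_mem he₀, Finset.card_erase_of_mem (mem_comp_self _ _)] at hcard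
  have := (hF' e₀ he₀).2.2
  have := Finset.card_pos.2 ⟨w, mem_comp_self (Z.erase e₀) w⟩
  omega

/-- In increasing order the j-th exponent, counted from 1, is at least j. The induction removes one
exceeding `n` while n + 1 are left. -/
lemma sum_pow_le_geom_sum {ι : Type*} [DecidableEq ι] {x : ℝ} (hx0 : 0 ≤ x) (hx1 : x ≤ 1)
    (s : Finset ι) (h : ι → ℕ) (hs : ∀ k, (s.filter fun i => h i ≤ k).card ≤ k) :
    ∑ i ∈ s, x ^ h i ≤ ∑ k ∈ Finset.range s.card, x ^ k := by
  induction hn : s.card generalizing s with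
  | zero => rw [Finset.card_eq_zero.1 hn]; simp
  | succ n ih =>
    obtain ⟨i, hi, hin⟩ : ∃ i ∈ s, n < h i := by
      by_contra! hcon
      have := hs n
      rw [Finset.filter_true_of_mem hcon] at this
      omega
    rw [← Finset.add_sum_erase s _ hi, Finset.sum_range_succ, add_comm]
    refine add_le_add (ih _ (fun k => ?_) ?_) (pow_le_pow_of_le_one hx0 hx1 hin.le)
    · exact (Finset.card_le_card (Finset.filter_subset_filter _ (Finset.erase_subset i s))).trans
        (hs k)
    · rw [Finset.card_erase_of_mem hi, hn]; rfl

lemma geom_sum_le {x : ℝ} (hx0 : 0 ≤ x) (hx1 : x < 1) (n : ℕ) :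
    ∑ k ∈ Finset.range n, x ^ k ≤ 1 / (1 - x) := by
  rw [le_div_iff₀ (by linarith), geom_sum_mul_neg]
  linarith [pow_nonneg hx0 n]

lemma nat_mul_pow_le {x : ℝ} (hx0 : 0 ≤ x) (hx1 : x < 1) (n : ℕ) :
    n * x ^ n ≤ 1 / (1 - x) := by
  refine le_trans ?_ (geom_sum_le hx0 hx1 n)
  have : (n : ℝ) * x ^ n = ∑ _k ∈ Finset.range n, x ^ n := by simp
  rw [this]
  exact Finset.sum_le_sum fun k hk =>
    pow_le_pow_of_le_one hx0 hx1.le (Finset.mem_range.1 hk).le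

end Components

/-! ### Conditional edge probabilities of the random cluster model -/

section Marginals

variable {V : Type*} [Fintype V] [DecidableEq V] {G : SimpleGraph V} [DecidableRel G.Adj]

/-- `∏_{j ∈ U} λ_j`. -/
def vertexProd (lam : V → ℝ) (U : Finset V) : ℝ := ∏ j ∈ U, lam j

/-- The product of the component factors. -/
def compProd (lam : V → ℝ) (S : Finset G.edgeSet) : ℝ :=
  ∏ U ∈ Finset.univ.image (comp S), (1 + vertexProd lam U)

lemma rcWeight_eq (p : G.edgeSet → ℝ) (lam : V → ℝ) (S : Finset G.edgeSet) :
    rcWeight G p lam S =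
      (∏ e ∈ S, p e) * (∏ e ∈ Finset.univ \ S, (1 - p e)) * compProd lam S := by
  classical
  unfold rcWeight compProd
  congr 1
  let φ : (spanning G S).ConnectedComponent → Finset V := fun C =>
    Finset.univ.filter fun j => (spanning G S).connectedComponentMk j = C
  have hφ : Function.Injective φ := by
    intro C C' h
    induction C using SimpleGraph.ConnectedComponent.ind with
    | _ v =>
      have : v ∈ φ ((spanning G S).connectedComponentMk v) := by simp [φ]
      rw [h] at this
      simpa [φ] using this
  have himage : Finset.univ.image (comp S) = Finset.univ.image φ := by
    have hmk : ∀ v, φ ((spanning G S).connectedComponentMk v) = comp S v := by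
      intro v
      ext x
      simp only [φ, Finset.mem_filter, Finset.mem_univ, true_and, mem_comp,
        SimpleGraph.ConnectedComponent.eq]
      exact SimpleGraph.reachable_comm
    ext U
    simp only [Finset.mem_image, Finset.mem_univ, true_and]
    constructor
    · rintro ⟨v, rfl⟩; exact ⟨_, hmk v⟩
    · rintro ⟨C, rfl⟩
      induction C using SimpleGraph.ConnectedComponent.ind with
      | _ v => exact ⟨v, (hmk v).symm⟩
  rw [himage, Finset.prod_image fun _ _ _ _ h => hφ h]
  rfl

/-- The factor by which absence of an edge with ends `a`, `b` is favoured, minus one. -/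
def excess (lam : V → ℝ) (H : Finset G.edgeSet) (a b : V) : ℝ :=
  if b ∈ comp H a then 0 else
    (vertexProd lam (comp H a) + vertexProd lam (comp H b)) /
      (1 + vertexProd lam (comp H a) * vertexProd lam (comp H b))

lemma vertexProd_nonneg {lam : V → ℝ} (h0 : ∀ v, 0 ≤ lam v) (U : Finset V) :
    0 ≤ vertexProd lam U :=
  Finset.prod_nonneg fun v _ => h0 v

lemma vertexProd_le_pow {lam : V → ℝ} (h0 : ∀ v, 0 ≤ lam v) {x : ℝ} (hx : ∀ v, lam v ≤ x)
    (U : Finset V) : vertexProd lam U ≤ x ^ U.card :=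
  (Finset.prod_le_prod (fun v _ => h0 v) fun v _ => hx v).trans_eq (by simp)

lemma vertexProd_anti {lam : V → ℝ} (h0 : ∀ v, 0 ≤ lam v) (h1 : ∀ v, lam v ≤ 1)
    {U U' : Finset V} (h : U ⊆ U') : vertexProd lam U' ≤ vertexProd lam U := by
  unfold vertexProd
  rw [← Finset.prod_sdiff h]
  exact mul_le_of_le_one_left (vertexProd_nonneg h0 U)
    (Finset.prod_le_one (fun v _ => h0 v) fun v _ => h1 v)

lemma vertexProd_le_one {lam : V → ℝ} (h0 : ∀ v, 0 ≤ lam v) (h1 : ∀ v, lam v ≤ 1)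
    (U : Finset V) : vertexProd lam U ≤ 1 :=
  Finset.prod_le_one (fun v _ => h0 v) fun v _ => h1 v

lemma compProd_pos {lam : V → ℝ} (h0 : ∀ v, 0 ≤ lam v) (S : Finset G.edgeSet) :
    0 < compProd lam S :=
  Finset.prod_pos fun U _ => by linarith [vertexProd_nonneg h0 U]

/-- Joining components of weights α, β replaces (1 + α)(1 + β) by 1 + αβ, and the quotient is 1 + (α
+ β)/(1 + αβ). -/
lemma compProd_eq_mul_excess {lam : V → ℝ} (h0 : ∀ v, 0 ≤ lam v) (H : Finset G.edgeSet)
    {e : G.edgeSet} {a b : V} (he : (e : Sym2 V) = s(a, b)) :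
    compProd lam H = compProd lam (insert e H) * (1 + excess lam H a b) := by
  unfold excess
  split_ifs with hab
  · have : comp (insert e H) = comp H := funext (comp_insert_of_mem he hab)
    simp [compProd, this]
  · set A := comp H a with hA
    set B := comp H b with hB
    have hbB : b ∈ B := mem_comp_self H b
    have haA : a ∈ A := mem_comp_self H a
    have hdisj : Disjoint A B := by
      rw [Finset.disjoint_left]
      intro x hxA hxB
      apply hab
      rw [hA, ← comp_eq_of_mem hxA, comp_eq_of_mem hxB]
      exact hbB
    have hne : A ≠ B := fun h => hab (h ▸ hbB)
    set R := ((Finset.univ.image (comp H)).erase A).erase B with hR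
    have hBI : B ∈ (Finset.univ.image (comp H)).erase A :=
      Finset.mem_erase.2 ⟨hne.symm, Finset.mem_image_of_mem _ (Finset.mem_univ b)⟩
    have hAI : A ∈ Finset.univ.image (comp H) := Finset.mem_image_of_mem _ (Finset.mem_univ a)
    have hAB : A ∪ B ∉ R := by
      intro h
      have h1 := Finset.mem_of_mem_erase (Finset.mem_of_mem_erase h)
      obtain ⟨x, -, hx⟩ := Finset.mem_image.1 h1
      have h2 : a ∈ comp H x := hx ▸ Finset.mem_union_left _ haA
      rw [← comp_eq_of_mem h2, ← hA] at hx
      exact hab (hx ▸ Finset.mem_union_right _ hbB)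
    have himage : Finset.univ.image (comp (insert e H)) = insert (A ∪ B) R := by
      ext U
      simp only [Finset.mem_image, Finset.mem_univ, true_and, Finset.mem_insert, hR,
        Finset.mem_erase]
      constructor
      · rintro ⟨x, rfl⟩
        rw [comp_insert he]
        split_ifs with hx
        · exact Or.inl rfl
        · refine Or.inr ⟨fun h => hx ?_, fun h => hx ?_, x, rfl⟩
          · exact Finset.mem_union_right _ (h.le (mem_comp_self H x))
          · exact Finset.mem_union_left _ (h.le (mem_comp_self H x))
      · rintro (rfl | ⟨h1, h2, x, rfl⟩)
        · exact ⟨a, by rw [comp_insert he, if_pos (Finset.mem_union_left _ haA)]⟩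
        · refine ⟨x, ?_⟩
          rw [comp_insert he, if_neg]
          intro hx
          rcases Finset.mem_union.1 hx with hx | hx
          · exact h2 (comp_eq_of_mem hx)
          · exact h1 (comp_eq_of_mem hx)
    have hprod : vertexProd lam (A ∪ B) = vertexProd lam A * vertexProd lam B :=
      Finset.prod_union hdisj
    have hpos : (0 : ℝ) < 1 + vertexProd lam A * vertexProd lam B := by
      have := mul_nonneg (vertexProd_nonneg h0 A) (vertexProd_nonneg h0 B)
      linarith
    unfold compProd
    rw [himage, Finset.prod_insert hAB, ← Finset.mul_prod_erase _ _ hAI,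
      ← Finset.mul_prod_erase _ _ hBI, hprod]
    field_simp
    ring

lemma rcWeight_pos {p : G.edgeSet → ℝ} (hp : ∀ e, 0 < p e ∧ p e < 1) {lam : V → ℝ}
    (h0 : ∀ v, 0 ≤ lam v) (S : Finset G.edgeSet) : 0 < rcWeight G p lam S := by
  rw [rcWeight_eq]
  exact mul_pos (mul_pos (Finset.prod_pos fun e _ => (hp e).1)
    (Finset.prod_pos fun e _ => sub_pos.2 (hp e).2)) (compProd_pos h0 S)

lemma rcDist_pos {p : G.edgeSet → ℝ} (hp : ∀ e, 0 < p e ∧ p e < 1) {lam : V → ℝ}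
    (h0 : ∀ v, 0 ≤ lam v) (S : Finset G.edgeSet) : 0 < rcDist G p lam S :=
  div_pos (rcWeight_pos hp h0 S)
    (Finset.sum_pos (fun T _ => rcWeight_pos hp h0 T) Finset.univ_nonempty)

lemma sum_rcDist {p : G.edgeSet → ℝ} (hp : ∀ e, 0 < p e ∧ p e < 1) {lam : V → ℝ}
    (h0 : ∀ v, 0 ≤ lam v) : ∑ S, rcDist G p lam S = 1 := by
  unfold rcDist
  rw [← Finset.sum_div]
  exact div_self
    (Finset.sum_pos (fun T _ => rcWeight_pos hp h0 T) Finset.univ_nonempty).ne'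

lemma marginal_rcDist {p : G.edgeSet → ℝ} (hp : ∀ e, 0 < p e ∧ p e < 1) {lam : V → ℝ}
    (h0 : ∀ v, 0 ≤ lam v) (X : Finset G.edgeSet) {e : G.edgeSet} {a b : V}
    (he : (e : Sym2 V) = s(a, b)) :
    marginal (rcDist G p lam) e X = p e / (1 + (1 - p e) * excess lam (X.erase e) a b) := by
  set H := X.erase e with hH
  have hins : insert e X = insert e H := by
    ext x; by_cases hx : x = e <;> simp [hH, hx]
  have heH : e ∉ H := Finset.notMem_erase e X
  have hZ : (0 : ℝ) < ∑ T, rcWeight G p lam T :=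
    Finset.sum_pos (fun T _ => rcWeight_pos hp h0 T) Finset.univ_nonempty
  have hc : Finset.univ \ H = insert e (Finset.univ \ insert e H) := by
    ext x; by_cases hx : x = e <;> simp [hH, hx]
  have hw := rcWeight_pos hp h0 (insert e H)
  have h1 : rcWeight G p lam (insert e H) = p e * ((∏ x ∈ H, p x) *
      (∏ x ∈ Finset.univ \ insert e H, (1 - p x)) * compProd lam (insert e H)) := by
    rw [rcWeight_eq, Finset.prod_insert heH]; ring
  have h2 : rcWeight G p lam H = (1 - p e) * (1 + excess lam H a b) * ((∏ x ∈ H, p x) *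
      (∏ x ∈ Finset.univ \ insert e H, (1 - p x)) * compProd lam (insert e H)) := by
    rw [rcWeight_eq, hc, Finset.prod_insert (by simp), compProd_eq_mul_excess h0 H he]; ring
  rw [h1] at hw
  have hne := (pos_of_mul_pos_right hw (hp e).1.le).ne'
  rw [marginal, ← hH, hins, rcDist, rcDist, ← add_div, div_div_div_cancel_right₀ hZ.ne', h1, h2,
    ← add_mul, mul_div_mul_right _ _ hne]
  congr 1
  ring

end Marginals

/-! ### The influence of an edge on the conditional probabilities of the others -/

section Influence

variable {V : Type*} [Fintype V] [DecidableEq V] {G : SimpleGraph V} [DecidableRel G.Adj]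

/-- After cross-multiplication the difference is (x − x')(1 − y²). -/
lemma add_div_one_add_mul_mono {x x' y : ℝ} (h0 : 0 ≤ x') (h : x' ≤ x) (hy0 : 0 ≤ y)
    (hy1 : y ≤ 1) : (x' + y) / (1 + x' * y) ≤ (x + y) / (1 + x * y) := by
  have h1 : 0 ≤ x' * y := mul_nonneg h0 hy0
  have h2 : 0 ≤ x * y := mul_nonneg (h0.trans h) hy0
  rw [div_le_div_iff₀ (by linarith) (by linarith)]
  nlinarith [mul_nonneg (sub_nonneg.2 h) (sub_nonneg.2 (mul_le_one₀ hy1 hy0 hy1))]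

lemma add_div_one_add_mul_le {x x' y : ℝ} (h0 : 0 ≤ x') (h : x' ≤ x) (hy0 : 0 ≤ y) :
    (x + y) / (1 + x * y) ≤ (x' + y) / (1 + x' * y) + x := by
  have h1 : 0 ≤ x' * y := mul_nonneg h0 hy0
  have h2 : x' * y ≤ x * y := mul_le_mul_of_nonneg_right h hy0
  have h3 : x / (1 + x * y) ≤ x := div_le_self (h0.trans h) (by linarith)
  have h4 : y / (1 + x * y) ≤ y / (1 + x' * y) :=
    div_le_div_of_nonneg_left hy0 (by linarith) (by linarith)
  have h5 : 0 ≤ x' / (1 + x' * y) := div_nonneg h0 (by linarith)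
  rw [add_div, add_div]
  linarith

/-- The weight of the component of `w` if `e` leaves it, and `0` otherwise. -/
def cutTerm (lam : V → ℝ) (H : Finset G.edgeSet) (e : G.edgeSet) (w : V) : ℝ :=
  if e ∈ bdry G (comp H w) then vertexProd lam (comp H w) else 0

variable {lam : V → ℝ} (h0 : ∀ v, 0 ≤ lam v)
include h0

lemma cutTerm_nonneg (H : Finset G.edgeSet) (e : G.edgeSet) (w : V) : 0 ≤ cutTerm lam H e w := by
  unfold cutTerm
  split_ifs
  exacts [vertexProd_nonneg h0 _, le_rfl]

lemma excess_nonneg (H : Finset G.edgeSet) (a b : V) : 0 ≤ excess lam H a b := by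
  unfold excess
  have h1 := vertexProd_nonneg h0 (comp H a)
  have h2 := vertexProd_nonneg h0 (comp H b)
  split_ifs
  exacts [le_rfl, by positivity]

variable (h1 : ∀ v, lam v ≤ 1)
include h1

lemma excess_le_one (H : Finset G.edgeSet) (a b : V) : excess lam H a b ≤ 1 := by
  unfold excess
  have h2 := vertexProd_nonneg h0 (comp H a)
  have h3 := vertexProd_nonneg h0 (comp H b)
  have h4 := vertexProd_le_one h0 h1 (comp H a)
  have h5 := vertexProd_le_one h0 h1 (comp H b)
  split_ifs
  · norm_num
  · rw [div_le_one (by positivity)]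
    nlinarith [mul_nonneg (sub_nonneg.2 h4) (sub_nonneg.2 h5)]

/-- Inserting `f` merges at most the components of `u` and `v`. Merging lowers the weight seen from
an end of `e`, or joins both ends. The loss is at most the old weights of the merged components
containing an end of `e`; since `e` leaves those, they are cut terms at `u` or `v`. -/
lemma excess_insert (H : Finset G.edgeSet) {e f : G.edgeSet} {a b u v : V}
    (he : (e : Sym2 V) = s(a, b)) (hf : (f : Sym2 V) = s(u, v)) :
    excess lam (insert f H) a b ≤ excess lam H a b ∧
      excess lam H a b ≤ excess lam (insert f H) a b +
        (cutTerm lam H e u + cutTerm lam H e v) := by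
  have hu := cutTerm_nonneg h0 H e u
  have hv := cutTerm_nonneg h0 H e v
  have hE := excess_nonneg h0 (insert f H) a b
  by_cases hab : b ∈ comp H a
  · have hz : excess lam H a b = 0 := if_pos hab
    have hz' : excess lam (insert f H) a b = 0 :=
      if_pos (comp_mono (Finset.subset_insert f H) a hab)
    rw [hz, hz']
    exact ⟨le_rfl, by linarith⟩
  by_cases huv : v ∈ comp H u
  · have hcomp := comp_insert_of_mem hf huv
    have : excess lam (insert f H) a b = excess lam H a b := by
      simp only [excess, hcomp]
    rw [this]
    exact ⟨le_rfl, by linarith⟩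
  set α := vertexProd lam (comp H a) with hα
  set β := vertexProd lam (comp H b) with hβ
  have hα0 : 0 ≤ α := vertexProd_nonneg h0 _
  have hβ0 : 0 ≤ β := vertexProd_nonneg h0 _
  have hα1 : α ≤ 1 := vertexProd_le_one h0 h1 _
  have hβ1 : β ≤ 1 := vertexProd_le_one h0 h1 _
  have hexc : excess lam H a b = (α + β) / (1 + α * β) := if_neg hab
  have hcutb : b ∉ comp H a → e ∈ bdry G (comp H a) := fun h =>
    mem_bdry.2 ⟨a, mem_comp_self H a, b, h, he⟩
  have hcuta : e ∈ bdry G (comp H b) :=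
    mem_bdry.2 ⟨b, mem_comp_self H b, a, fun h => hab (mem_comp_comm.1 h), by
      rw [he, Sym2.eq_swap]⟩
  have hterma : ∀ w, a ∈ comp H w → cutTerm lam H e w = α := fun w hw => by
    rw [cutTerm, ← comp_eq_of_mem hw, if_pos (hcutb hab)]
  have htermb : ∀ w, b ∈ comp H w → cutTerm lam H e w = β := fun w hw => by
    rw [cutTerm, ← comp_eq_of_mem hw, if_pos hcuta]
  have hnot : ∀ w, a ∈ comp H w → b ∈ comp H w → False := fun w ha hb => by
    rw [← comp_eq_of_mem ha] at hb; exact hab hb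
  set M := comp H u ∪ comp H v with hM
  have hMa : a ∈ M → vertexProd lam M ≤ α := fun h => by
    refine vertexProd_anti h0 h1 ?_
    rcases Finset.mem_union.1 h with h | h
    · exact (comp_eq_of_mem h).le.trans Finset.subset_union_left
    · exact (comp_eq_of_mem h).le.trans Finset.subset_union_right
  have hMb : b ∈ M → vertexProd lam M ≤ β := fun h => by
    refine vertexProd_anti h0 h1 ?_
    rcases Finset.mem_union.1 h with h | h
    · exact (comp_eq_of_mem h).le.trans Finset.subset_union_left
    · exact (comp_eq_of_mem h).le.trans Finset.subset_union_right
  have hsuma : a ∈ M → α ≤ cutTerm lam H e u + cutTerm lam H e v := fun h => by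
    rcases Finset.mem_union.1 h with h | h
    · rw [hterma u h]; linarith
    · rw [hterma v h]; linarith
  have hsumb : b ∈ M → β ≤ cutTerm lam H e u + cutTerm lam H e v := fun h => by
    rcases Finset.mem_union.1 h with h | h
    · rw [htermb u h]; linarith
    · rw [htermb v h]; linarith
  have hM0 : 0 ≤ vertexProd lam M := vertexProd_nonneg h0 _
  have hca := comp_insert (S := H) hf a
  have hcb := comp_insert (S := H) hf b
  by_cases ha : a ∈ M
  · rw [if_pos ha] at hca
    by_cases hb : b ∈ M
    · have hz' : excess lam (insert f H) a b = 0 := if_pos (hca ▸ hb)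
      have hab' : α + β ≤ cutTerm lam H e u + cutTerm lam H e v := by
        rcases Finset.mem_union.1 ha with ha | ha <;> rcases Finset.mem_union.1 hb with hb | hb
        · exact (hnot u ha hb).elim
        · rw [hterma u ha, htermb v hb]
        · rw [hterma v ha, htermb u hb, add_comm]
        · exact (hnot v ha hb).elim
      have hle : (α + β) / (1 + α * β) ≤ α + β :=
        div_le_self (by linarith) (by linarith [mul_nonneg hα0 hβ0])
      rw [hz', hexc]
      exact ⟨by positivity, by linarith⟩
    · rw [if_neg hb] at hcb
      have he' : excess lam (insert f H) a b =
          (vertexProd lam M + β) / (1 + vertexProd lam M * β) := by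
        rw [excess, hca, hcb, if_neg hb]
      rw [he', hexc]
      refine ⟨add_div_one_add_mul_mono hM0 (hMa ha) hβ0 hβ1, ?_⟩
      have := add_div_one_add_mul_le hM0 (hMa ha) hβ0
      linarith [hsuma ha]
  · rw [if_neg ha] at hca
    by_cases hb : b ∈ M
    · rw [if_pos hb] at hcb
      have he' : excess lam (insert f H) a b =
          (vertexProd lam M + α) / (1 + vertexProd lam M * α) := by
        rw [excess, hca, hcb, if_neg hab, ← hα, add_comm, mul_comm α]
      rw [he', hexc, add_comm α, mul_comm α]
      refine ⟨add_div_one_add_mul_mono hM0 (hMb hb) hα0 hα1, ?_⟩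
      have := add_div_one_add_mul_le hM0 (hMb hb) hα0
      linarith [hsumb hb]
    · rw [if_neg hb] at hcb
      have he' : excess lam (insert f H) a b = excess lam H a b := by
        rw [excess, hca, hcb]; rfl
      rw [he']
      exact ⟨le_rfl, by linarith⟩

omit h0 h1 in
lemma abs_div_sub_div_le {p q x y : ℝ} (hp0 : 0 < p) (hp1 : p < 1) (hq : 1 - p ≤ q)
    (hx : 0 ≤ x) (hy : 0 ≤ y) :
    |p / (1 + (1 - p) * x) - p / (1 + (1 - p) * y)| ≤ q * |x - y| := by
  have hp : 0 < 1 - p := sub_pos.2 hp1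
  have hx' : 1 ≤ 1 + (1 - p) * x := by linarith [mul_nonneg hp.le hx]
  have hy' : 1 ≤ 1 + (1 - p) * y := by linarith [mul_nonneg hp.le hy]
  have h : p / (1 + (1 - p) * x) - p / (1 + (1 - p) * y) =
      p * ((1 - p) * (y - x)) / ((1 + (1 - p) * x) * (1 + (1 - p) * y)) := by
    field_simp
    ring
  rw [h, abs_div, abs_mul, abs_mul, abs_of_pos hp0, abs_of_pos hp, abs_sub_comm y x,
    abs_of_pos (by positivity : 0 < (1 + (1 - p) * x) * (1 + (1 - p) * y))]
  refine (div_le_self (by positivity) (one_le_mul_of_one_le_of_one_le hx' hy')).trans ?_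
  calc p * ((1 - p) * |x - y|) ≤ 1 * ((1 - p) * |x - y|) :=
        mul_le_mul_of_nonneg_right hp1.le (by positivity)
    _ = (1 - p) * |x - y| := one_mul _
    _ ≤ q * |x - y| := mul_le_mul_of_nonneg_right hq (abs_nonneg _)

variable {x : ℝ} (hx : ∀ v, lam v ≤ x) (hx1 : x < 1)
include hx hx1

-- Edges of `Z` count only when they are bridges, and `card_bridges_le` yields a geometric series.
-- All edges outside `Z` see the same component C, with at most L|C| boundary edges of weight at
-- most x^|C|.
omit h1 in
lemma sum_cutTerm_le {L : ℝ} (hL : 0 ≤ L) {Z : Finset G.edgeSet} (hZ : SmallBoundary L Z)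
    (w : V) : ∑ e, cutTerm lam (Z.erase e) e w ≤ (1 + L) / (1 - x) := by
  have hx0 : 0 ≤ x := (h0 w).trans (hx w)
  have hle : ∀ H : Finset G.edgeSet, vertexProd lam (comp H w) ≤ x ^ (comp H w).card := fun H =>
    vertexProd_le_pow h0 hx _
  rw [← Finset.sum_add_sum_compl Z, add_div]
  refine add_le_add ?_ ?_
  · simp only [cutTerm]
    rw [← Finset.sum_filter]
    exact (Finset.sum_le_sum fun e _ => hle (Z.erase e)).trans
      ((sum_pow_le_geom_sum hx0 hx1.le _ (fun e => (comp (Z.erase e) w).card)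
        (card_bridges_le Z w)).trans (geom_sum_le hx0 hx1 _))
  · have h : ∀ e ∈ Zᶜ, cutTerm lam (Z.erase e) e w =
        if e ∈ bdry G (comp Z w) then vertexProd lam (comp Z w) else 0 := fun e he => by
      rw [Finset.erase_eq_of_notMem (Finset.mem_compl.1 he), cutTerm]
    rw [Finset.sum_congr rfl h]
    calc _ ≤ ∑ e, if e ∈ bdry G (comp Z w) then vertexProd lam (comp Z w) else 0 :=
          Finset.sum_le_univ_sum_of_nonneg fun e => by
            split_ifs
            exacts [vertexProd_nonneg h0 _, le_rfl]
      _ = (bdry G (comp Z w)).card * vertexProd lam (comp Z w) := by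
          rw [Finset.sum_ite_mem, Finset.univ_inter, Finset.sum_const, nsmul_eq_mul]
      _ ≤ (L * (comp Z w).card) * x ^ (comp Z w).card :=
          mul_le_mul (hZ w) (hle Z) (vertexProd_nonneg h0 _) (by positivity)
      _ = L * ((comp Z w).card * x ^ (comp Z w).card) := by ring
      _ ≤ L * (1 / (1 - x)) := mul_le_mul_of_nonneg_left (nat_mul_pow_le hx0 hx1 _) hL
      _ = L / (1 - x) := by ring

variable {p : G.edgeSet → ℝ} (hp : ∀ e, 0 < p e ∧ p e < 1) {q : ℝ} (hq : ∀ e, 1 - p e ≤ q)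
include hp hq

-- Since `excess` is at most 1, the marginal is at least p/(2 − p) ≥ 1 − 2(1 − p).
omit hx hx1 in
lemma one_sub_two_mul_le_marginal (e : G.edgeSet) (X : Finset G.edgeSet) :
    1 - 2 * q ≤ marginal (rcDist G p lam) e X := by
  obtain ⟨a, b, he⟩ := exists_eq_mk e
  rw [marginal_rcDist hp h0 X he]
  have h2 := excess_nonneg h0 (X.erase e) a b
  have h3 := excess_le_one h0 h1 (X.erase e) a b
  obtain ⟨hp0, hp1⟩ := hp e
  have h4 : 0 ≤ (1 - p e) * excess lam (X.erase e) a b := mul_nonneg (by linarith) h2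
  have h5 : (1 - p e) * excess lam (X.erase e) a b ≤ 1 - p e :=
    mul_le_of_le_one_right (by linarith) h3
  refine (by linarith [hq e] : 1 - 2 * q ≤ 1 - 2 * (1 - p e)).trans ?_
  rw [le_div_iff₀ (by linarith)]
  by_cases h6 : 1 - 2 * (1 - p e) ≤ 0
  · nlinarith
  · nlinarith

lemma sum_abs_marginal_insert_sub_le {L : ℝ} (hL : 0 ≤ L) {Z : Finset G.edgeSet}
    (hZ : SmallBoundary L Z) (f : G.edgeSet) :
    ∑ e, |marginal (rcDist G p lam) e (insert f Z) - marginal (rcDist G p lam) e Z| ≤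
      2 * (q * (1 + L) / (1 - x)) := by
  obtain ⟨u, v, hf⟩ := exists_eq_mk f
  have hq0 : 0 ≤ q := (sub_pos.2 (hp f).2).le.trans (hq f)
  have hmain : ∀ e,
      |marginal (rcDist G p lam) e (insert f Z) - marginal (rcDist G p lam) e Z| ≤
        q * (cutTerm lam (Z.erase e) e u + cutTerm lam (Z.erase e) e v) := by
    intro e
    have hnn := add_nonneg (cutTerm_nonneg h0 (Z.erase e) e u) (cutTerm_nonneg h0 (Z.erase e) e v)
    by_cases hef : e = f
    · subst hef
      rw [marginal_insert, sub_self, abs_zero]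
      exact mul_nonneg hq0 hnn
    · obtain ⟨a, b, he⟩ := exists_eq_mk e
      rw [marginal_rcDist hp h0 _ he, marginal_rcDist hp h0 _ he,
        Finset.erase_insert_of_ne (Ne.symm hef)]
      obtain ⟨h2, h3⟩ := excess_insert h0 h1 (Z.erase e) he hf
      refine (abs_div_sub_div_le (hp e).1 (hp e).2 (hq e) (excess_nonneg h0 _ _ _)
        (excess_nonneg h0 _ _ _)).trans (mul_le_mul_of_nonneg_left ?_ hq0)
      rw [abs_sub_comm, abs_of_nonneg (by linarith)]
      linarith
  refine (Finset.sum_le_sum fun e _ => hmain e).trans ?_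
  rw [← Finset.mul_sum, Finset.sum_add_distrib]
  have h2 := sum_cutTerm_le h0 hx hx1 hL hZ u
  have h3 := sum_cutTerm_le h0 hx hx1 hL hZ v
  have h4 := mul_le_mul_of_nonneg_left (add_le_add h2 h3) hq0
  refine h4.trans (le_of_eq ?_)
  ring

lemma sum_abs_marginal_union_sub_le {L : ℝ} (hL : 0 ≤ L) {Z : Finset G.edgeSet}
    (hZ : SmallBoundary L Z) (D : Finset G.edgeSet) :
    ∑ e, |marginal (rcDist G p lam) e (Z ∪ D) - marginal (rcDist G p lam) e Z| ≤
      2 * (q * (1 + L) / (1 - x)) * D.card := by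
  induction D using Finset.induction_on with
  | empty => simp
  | insert f D hf ih =>
    rw [Finset.union_insert, Finset.card_insert_of_notMem hf]
    have h2 := sum_abs_marginal_insert_sub_le h0 h1 hx hx1 hp hq hL
      (hZ.mono (Finset.subset_union_left (s₂ := D))) f
    have h3 := add_le_add h2 ih
    rw [← Finset.sum_add_distrib] at h3
    refine (Finset.sum_le_sum fun e _ => abs_sub_le _
      (marginal (rcDist G p lam) e (Z ∪ D)) _).trans (h3.trans (le_of_eq ?_))
    push_cast
    ring

/-- Both configurations are compared with S ∪ W, because boundaries stay small along upward paths.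
-/
lemma sum_abs_marginal_sub_le {L : ℝ} (hL : 0 ≤ L) {S W : Finset G.edgeSet}
    (hS : SmallBoundary L S) (hW : SmallBoundary L W) :
    ∑ e, |marginal (rcDist G p lam) e S - marginal (rcDist G p lam) e W| ≤
      2 * (q * (1 + L) / (1 - x)) * (symmDiff S W).card := by
  have h2 := sum_abs_marginal_union_sub_le h0 h1 hx hx1 hp hq hL hS (W \ S)
  have h3 := sum_abs_marginal_union_sub_le h0 h1 hx hx1 hp hq hL hW (S \ W)
  have hU : W ∪ (S \ W) = S ∪ (W \ S) := by
    rw [Finset.union_sdiff_self_eq_union, Finset.union_sdiff_self_eq_union, Finset.union_comm]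
  rw [hU] at h3
  have hcard : ((symmDiff S W).card : ℝ) = (W \ S).card + (S \ W).card := by
    have h4 : symmDiff S W = (S \ W) ∪ (W \ S) := rfl
    rw [h4, Finset.card_union_of_disjoint disjoint_sdiff_sdiff]
    push_cast
    ring
  have h4 := add_le_add h2 h3
  rw [← Finset.sum_add_distrib] at h4
  refine (Finset.sum_le_sum fun e _ => ?_).trans (h4.trans (le_of_eq ?_))
  · rw [abs_sub_comm _ (marginal (rcDist G p lam) e S)]
    exact abs_sub_le _ _ _
  · rw [hcard]; ring

end Influence

/-! ### Boundaries of percolation clusters -/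

section Percolation

variable {V : Type*} [Fintype V] [DecidableEq V] {G : SimpleGraph V} [DecidableRel G.Adj]

/-- `T` plays the role of a spanning tree of the component; it is found by maximizing the component
among sets with few enough edges. -/
lemma exists_subset_comp_eq (S : Finset G.edgeSet) (v : V) :
    ∃ T ⊆ S, T.card + 1 ≤ (comp S v).card ∧ comp T v = comp S v := by
  classical
  set 𝒯 := S.powerset.filter fun T => T.card + 1 ≤ (comp T v).card with h𝒯
  have hne : 𝒯.Nonempty := ⟨∅, by
    have := Finset.card_pos.2 ⟨v, mem_comp_self (∅ : Finset G.edgeSet) v⟩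
    rw [h𝒯, Finset.mem_filter, Finset.mem_powerset, Finset.card_empty]
    exact ⟨Finset.empty_subset S, by omega⟩⟩
  obtain ⟨T, hT, hmax⟩ := Finset.exists_max_image 𝒯 (fun T => (comp T v).card) hne
  obtain ⟨hTS, hTc⟩ := Finset.mem_filter.1 hT
  rw [Finset.mem_powerset] at hTS
  have heq : comp T v = comp S v := by
    refine (comp_mono hTS v).antisymm (comp_subset_of_closed (mem_comp_self T v) ?_)
    intro e he a b hab ha
    by_contra hb
    have heT : e ∉ T := fun h => hb (comp_closed h hab ha)
    have hmono := comp_mono (Finset.subset_insert e T) v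
    have hb' : b ∈ comp (insert e T) v :=
      comp_closed (Finset.mem_insert_self e T) hab (hmono ha)
    have hlt : (comp T v).card < (comp (insert e T) v).card :=
      Finset.card_lt_card ⟨hmono, fun h => hb (h hb')⟩
    have hmem : insert e T ∈ 𝒯 := by
      rw [h𝒯, Finset.mem_filter, Finset.mem_powerset, Finset.card_insert_of_notMem heT]
      exact ⟨Finset.insert_subset he hTS, by omega⟩
    exact absurd (hmax _ hmem) (not_le.2 hlt)
  exact ⟨T, hTS, heq ▸ hTc, heq⟩

variable {E : Type*} [Fintype E] [DecidableEq E] in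
lemma sum_prodLaw_disjoint (l : ℝ) (B : Finset E) :
    ∑ S, prodLaw (fun _ : E => l) S * (if Disjoint S B then 1 else 0) = (1 - l) ^ B.card := by
  have h : ∀ S : Finset E, prodLaw (fun _ : E => l) S * (if Disjoint S B then 1 else 0) =
      (∏ e ∈ S, if e ∈ B then 0 else l) * ∏ _e ∈ Finset.univ \ S, (1 - l) := by
    intro S
    split_ifs with hS
    · rw [prodLaw, mul_one]
      congr 1
      exact Finset.prod_congr rfl fun e he => (if_neg (Finset.disjoint_left.1 hS he)).symm
    · obtain ⟨e, heS, heB⟩ := Finset.not_disjoint_iff.1 hS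
      have h0 : ∏ e ∈ S, (if e ∈ B then 0 else l) = 0 :=
        Finset.prod_eq_zero heS (by simp [heB])
      rw [h0, mul_zero, zero_mul]
  simp only [h]
  rw [sum_prod_mul_prod_compl (fun e => if e ∈ B then 0 else l) fun _ => 1 - l]
  have : ∀ e, (if e ∈ B then 0 else l) + (1 - l) = if e ∈ B then 1 - l else 1 := by
    intro e; split_ifs <;> ring
  simp only [this]
  rw [Finset.prod_ite_mem, Finset.univ_inter, Finset.prod_const]

variable {E : Type*} [Fintype E] [DecidableEq E] in
lemma half_pow_le_sum {T B : Finset E} (hTB : Disjoint T B) :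
    (1 / 2 : ℝ) ^ (T.card + B.card) ≤
      ∑ S, (1 / 2 : ℝ) ^ Fintype.card E * (if T ⊆ S ∧ Disjoint S B then 1 else 0) := by
  have h : ∀ S : Finset E, (∏ e ∈ S, if e ∈ B then (0 : ℝ) else 1 / 2) *
      (∏ e ∈ Finset.univ \ S, if e ∈ T then (0 : ℝ) else 1 / 2) ≤
      (1 / 2 : ℝ) ^ Fintype.card E * (if T ⊆ S ∧ Disjoint S B then 1 else 0) := by
    intro S
    split_ifs with hS
    · have h1 : ∏ e ∈ S, (if e ∈ B then (0 : ℝ) else 1 / 2) = (1 / 2) ^ S.card := by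
        rw [← Finset.prod_const]
        exact Finset.prod_congr rfl fun e he => if_neg (Finset.disjoint_left.1 hS.2 he)
      have h2 : ∏ e ∈ Finset.univ \ S, (if e ∈ T then (0 : ℝ) else 1 / 2) =
          (1 / 2) ^ (Finset.univ \ S).card := by
        rw [← Finset.prod_const]
        exact Finset.prod_congr rfl fun e he => if_neg fun h => (Finset.mem_sdiff.1 he).2 (hS.1 h)
      rw [h1, h2, ← pow_add, mul_one, add_comm, Finset.card_sdiff_add_card_eq_card
        (Finset.subset_univ S), Finset.card_univ]
    · rw [mul_zero]
      rcases not_and_or.1 hS with hS | hS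
      · obtain ⟨e, heT, heS⟩ := Finset.not_subset.1 hS
        have h0 : ∏ e ∈ Finset.univ \ S, (if e ∈ T then (0 : ℝ) else 1 / 2) = 0 :=
          Finset.prod_eq_zero (i := e) (by simp [heS]) (by simp [heT])
        rw [h0, mul_zero]
      · obtain ⟨e, heS, heB⟩ := Finset.not_disjoint_iff.1 hS
        have h0 : ∏ e ∈ S, (if e ∈ B then (0 : ℝ) else 1 / 2) = 0 :=
          Finset.prod_eq_zero heS (by simp [heB])
        rw [h0, zero_mul]
  refine le_trans ?_ (Finset.sum_le_sum fun S _ => h S)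
  rw [sum_prod_mul_prod_compl (fun e => if e ∈ B then (0 : ℝ) else 1 / 2)
    fun e => if e ∈ T then (0 : ℝ) else 1 / 2]
  have : ∀ e, ((if e ∈ B then (0 : ℝ) else 1 / 2) + if e ∈ T then (0 : ℝ) else 1 / 2) =
      if e ∈ T ∪ B then 1 / 2 else 1 := by
    intro e
    have hTB' := fun h : e ∈ T => Finset.disjoint_left.1 hTB h
    by_cases hT : e ∈ T
    · simp [hT, hTB' hT]
    · by_cases hB : e ∈ B
      · simp [hT, hB]
      · simp only [hT, hB, Finset.mem_union, or_self, if_false]; norm_num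
  simp only [this]
  rw [Finset.prod_ite_mem, Finset.univ_inter, Finset.prod_const,
    Finset.card_union_of_disjoint hTB]

/-- The components of `v` have total weight at most one, when a component with `k` vertices and
`b` boundary edges weighs `2 ^ (-(b + k))`. -/
lemma sum_half_pow_components_le (G : SimpleGraph V) [DecidableRel G.Adj] (v : V) :
    ∑ C ∈ (Finset.univ : Finset (Finset G.edgeSet)).image (fun S => comp S v),
      (1 / 2 : ℝ) ^ ((bdry G C).card + C.card) ≤ 1 := by
  -- A uniformly random edge set has C as the component of `v` as soon as it contains a spanning
  -- tree of C and no boundary edge. These events are disjoint for different C.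
  have h : ∀ C ∈ (Finset.univ : Finset (Finset G.edgeSet)).image (fun S => comp S v),
      (1 / 2 : ℝ) ^ ((bdry G C).card + C.card) ≤ ∑ S : Finset G.edgeSet,
        (1 / 2 : ℝ) ^ Fintype.card G.edgeSet * (if comp S v = C then 1 else 0) := by
    intro C hC
    obtain ⟨S₀, -, rfl⟩ := Finset.mem_image.1 hC
    obtain ⟨T, hTS, hTc, hT⟩ := exists_subset_comp_eq S₀ v
    have hdisj : Disjoint T (bdry G (comp S₀ v)) :=
      Finset.disjoint_left.2 fun e he he' => notMem_of_mem_bdry_comp he' (hTS he)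
    refine le_trans (pow_le_pow_of_le_one (by norm_num) (by norm_num) (by omega))
      ((half_pow_le_sum hdisj).trans (Finset.sum_le_sum fun S _ =>
        mul_le_mul_of_nonneg_left ?_ (by positivity)))
    by_cases hS : T ⊆ S ∧ Disjoint S (bdry G (comp S₀ v))
    · have : comp S v = comp S₀ v := by
        refine (comp_subset_of_closed (mem_comp_self S₀ v) ?_).antisymm
          (hT.ge.trans (comp_mono hS.1 v))
        intro e he a b hab ha
        by_contra hb
        exact Finset.disjoint_left.1 hS.2 he (mem_bdry.2 ⟨a, ha, b, hb, hab⟩)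
      rw [if_pos hS, if_pos this]
    · rw [if_neg hS]
      split_ifs <;> norm_num
  refine (Finset.sum_le_sum h).trans ?_
  rw [Finset.sum_comm]
  simp only [← Finset.mul_sum, Finset.sum_ite_eq]
  have h2 : ∀ S : Finset G.edgeSet, (if comp S v ∈
      (Finset.univ : Finset (Finset G.edgeSet)).image (fun S => comp S v) then (1 : ℝ) else 0)
      = 1 := fun S => if_pos (Finset.mem_image_of_mem _ (Finset.mem_univ S))
  simp only [h2]
  rw [Finset.sum_const, Finset.card_univ, Fintype.card_finset]
  simp

open Classical in
/-- With high probability, the percolation clusters have small boundaries. -/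
lemma sum_prodLaw_not_smallBoundary_le (G : SimpleGraph V) [DecidableRel G.Adj] {l L η : ℝ}
    (h0 : 0 < l) (h1 : l < 1) (hη : 0 ≤ η)
    (h : ∀ b k : ℕ, 1 ≤ k → L * k < b → (1 - l) ^ b ≤ η * (1 / 2) ^ (b + k)) :
    ∑ S : Finset G.edgeSet, prodLaw (fun _ => l) S * (if SmallBoundary L S then 0 else 1) ≤
      Fintype.card V * η := by
  have hpos : ∀ S : Finset G.edgeSet, 0 ≤ prodLaw (fun _ => l) S := fun S =>
    (prodLaw_pos (fun _ => h0) (fun _ => h1) S).le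
  let bad : Finset V → Prop := fun C => L * C.card < (bdry G C).card
  -- Union bound over the bad clusters C of `v`: each needs its whole boundary absent, and `h`
  -- trades that probability for η times weights of total at most one.
  have hv : ∀ v, ∑ S : Finset G.edgeSet, prodLaw (fun _ => l) S *
      (if bad (comp S v) then 1 else 0) ≤ η := by
    intro v
    set 𝒞 := (Finset.univ : Finset (Finset G.edgeSet)).image (fun S => comp S v) with h𝒞
    calc ∑ S : Finset G.edgeSet, prodLaw (fun _ => l) S * (if bad (comp S v) then 1 else 0)
        ≤ ∑ S : Finset G.edgeSet, ∑ C ∈ 𝒞.filter bad,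
            prodLaw (fun _ => l) S * (if Disjoint S (bdry G C) then 1 else 0) := by
          refine Finset.sum_le_sum fun S _ => ?_
          rw [← Finset.mul_sum]
          refine mul_le_mul_of_nonneg_left ?_ (hpos S)
          have hnn : ∀ C ∈ 𝒞.filter bad, (0 : ℝ) ≤ if Disjoint S (bdry G C) then 1 else 0 :=
            fun C _ => by split_ifs <;> norm_num
          split_ifs with hb
          · have hC : comp S v ∈ 𝒞.filter bad :=
              Finset.mem_filter.2 ⟨Finset.mem_image_of_mem _ (Finset.mem_univ S), hb⟩
            have hd : Disjoint S (bdry G (comp S v)) :=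
              Finset.disjoint_left.2 fun e he he' => notMem_of_mem_bdry_comp he' he
            refine le_trans ?_ (Finset.single_le_sum hnn hC)
            rw [if_pos hd]
          · exact Finset.sum_nonneg hnn
      _ = ∑ C ∈ 𝒞.filter bad, (1 - l) ^ (bdry G C).card := by
          rw [Finset.sum_comm]
          exact Finset.sum_congr rfl fun C _ => by rw [sum_prodLaw_disjoint]
      _ ≤ ∑ C ∈ 𝒞.filter bad, η * (1 / 2) ^ ((bdry G C).card + C.card) := by
          refine Finset.sum_le_sum fun C hC => ?_
          obtain ⟨hC, hb⟩ := Finset.mem_filter.1 hC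
          obtain ⟨S, -, rfl⟩ := Finset.mem_image.1 hC
          exact h _ _ (Finset.card_pos.2 ⟨v, mem_comp_self S v⟩) hb
      _ ≤ ∑ C ∈ 𝒞, η * (1 / 2) ^ ((bdry G C).card + C.card) :=
          Finset.sum_le_sum_of_subset_of_nonneg (Finset.filter_subset _ _)
            fun C _ _ => by positivity
      _ ≤ η := by
          rw [← Finset.mul_sum]
          exact mul_le_of_le_one_right hη (sum_half_pow_components_le G v)
  calc _ ≤ ∑ S : Finset G.edgeSet, ∑ v, prodLaw (fun _ => l) S *
        (if bad (comp S v) then 1 else 0) := by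
        refine Finset.sum_le_sum fun S _ => ?_
        rw [← Finset.mul_sum]
        refine mul_le_mul_of_nonneg_left ?_ (hpos S)
        have hnn : ∀ v ∈ Finset.univ, (0 : ℝ) ≤ if bad (comp S v) then 1 else 0 :=
          fun v _ => by split_ifs <;> norm_num
        split_ifs with hS
        · exact Finset.sum_nonneg hnn
        · rw [SmallBoundary, not_forall] at hS
          obtain ⟨v, hv⟩ := hS
          refine le_trans ?_ (Finset.single_le_sum hnn (Finset.mem_univ v))
          rw [if_pos (not_le.1 hv)]
    _ = ∑ v, ∑ S : Finset G.edgeSet, prodLaw (fun _ => l) S *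
        (if bad (comp S v) then 1 else 0) := Finset.sum_comm
    _ ≤ ∑ _v : V, η := Finset.sum_le_sum fun v _ => hv v
    _ = Fintype.card V * η := by
        rw [Finset.sum_const, Finset.card_univ, nsmul_eq_mul]

end Percolation

/-! ### Quantitative estimates -/

section Estimates

lemma one_le_log_of_three_le {n : ℕ} (hn : 3 ≤ n) : 1 ≤ Real.log n := by
  rw [Real.le_log_iff_exp_le (by positivity)]
  have : (3 : ℝ) ≤ n := by exact_mod_cast hn
  linarith [Real.exp_one_lt_d9]

/-- Since 4 ≤ e², 4q ≤ e^{-(38 + c/L)}. As b > Lk, the b-th power is at most e^{-(38L + c)k} ≤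
e^{-(37L + c)} e^{-k}, using L, k ≥ 1. Passing from 4q to 2q supplies 2^{-b}. -/
lemma two_mul_pow_le_of_boundary {q L c η : ℝ} (hq : 0 < q) (hL : 1 ≤ L) (hc : 0 ≤ c)
    (hqL : q * L ≤ Real.exp (-40) * Real.exp (-(c / L)))
    (hη : η = Real.exp (-(37 * L + c))) {b k : ℕ} (hk : 1 ≤ k) (hb : L * k < b) :
    (2 * q) ^ b ≤ η * (1 / 2) ^ (b + k) := by
  have hk' : (1 : ℝ) ≤ k := Nat.one_le_cast.2 hk
  have hexp2 : (4 : ℝ) ≤ Real.exp 2 := by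
    have : Real.exp 2 = Real.exp 1 * Real.exp 1 := by rw [← Real.exp_add]; norm_num
    nlinarith [Real.add_one_le_exp (1 : ℝ)]
  have h1 : 4 * q ≤ Real.exp (-(38 + c / L)) := by
    have h2 : q ≤ q * L := le_mul_of_one_le_right hq.le hL
    rw [← Real.exp_add] at hqL
    calc 4 * q ≤ Real.exp 2 * Real.exp (-40 + -(c / L)) :=
          mul_le_mul hexp2 (h2.trans hqL) hq.le (Real.exp_pos _).le
      _ = Real.exp (-(38 + c / L)) := by rw [← Real.exp_add]; congr 1; ring
  have h2 : (4 * q) ^ b ≤ Real.exp (-((38 + c / L) * b)) := by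
    refine (pow_le_pow_left₀ (by positivity) h1 b).trans (le_of_eq ?_)
    rw [← Real.exp_nat_mul]; congr 1; ring
  have h3 : Real.exp (-(k : ℝ)) ≤ (1 / 2) ^ k := by
    have h4 : Real.exp (-1) ≤ 1 / 2 := by
      rw [Real.exp_neg, inv_eq_one_div]
      exact one_div_le_one_div_of_le (by norm_num) (by linarith [Real.add_one_le_exp (1 : ℝ)])
    refine le_trans (le_of_eq ?_) (pow_le_pow_left₀ (Real.exp_pos _).le h4 k)
    rw [← Real.exp_nat_mul]; congr 1; ring
  have h4 : (38 * L + c) * k ≤ (38 + c / L) * b := by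
    have : (38 * L + c) * k = (38 + c / L) * (L * k) := by field_simp
    rw [this]
    exact mul_le_mul_of_nonneg_left hb.le (by positivity)
  have h5 : Real.exp (-((38 + c / L) * b)) ≤ η * Real.exp (-(k : ℝ)) := by
    rw [hη, ← Real.exp_add]
    refine Real.exp_le_exp.2 ?_
    nlinarith [mul_nonneg (by linarith : 0 ≤ L - 1) (by linarith : (0 : ℝ) ≤ k),
      mul_nonneg (by linarith : 0 ≤ 37 * L + c) (by linarith : (0 : ℝ) ≤ k - 1)]
  have hη0 : 0 ≤ η := by rw [hη]; exact (Real.exp_pos _).le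
  have h6 : (4 * q) ^ b ≤ η * (1 / 2) ^ k :=
    h2.trans (h5.trans (mul_le_mul_of_nonneg_left h3 hη0))
  have h7 : (2 * q) ^ b = (4 * q) ^ b * (1 / 2) ^ b := by rw [← mul_pow]; congr 1; ring
  rw [h7, pow_add, mul_comm ((1 / 2 : ℝ) ^ b), ← mul_assoc]
  exact mul_le_mul_of_nonneg_right h6 (by positivity)

lemma mul_one_sub_pow_le {m ε : ℝ} (hm : 1 ≤ m) (hε : 0 < ε) {T : ℕ}
    (hT : 2 * m * (Real.log m + Real.log (4 / ε)) ≤ T) :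
    m * (1 - (2 * m)⁻¹) ^ T ≤ ε / 4 := by
  have hm0 : 0 < m := by linarith
  have h1 : 0 ≤ 1 - (2 * m)⁻¹ := sub_nonneg.2 (inv_le_one_of_one_le₀ (by linarith))
  have h2 : (1 - (2 * m)⁻¹) ^ T ≤ Real.exp (-(T / (2 * m))) := by
    refine (pow_le_pow_left₀ h1 (Real.one_sub_le_exp_neg _) T).trans (le_of_eq ?_)
    rw [← Real.exp_nat_mul]; congr 1; ring
  have h3 : Real.log m + Real.log (4 / ε) ≤ T / (2 * m) := by
    rw [le_div_iff₀ (by linarith)]; linarith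
  have h4 : Real.exp (-(T / (2 * m))) ≤ (m * (4 / ε))⁻¹ := by
    rw [← Real.exp_log (by positivity : 0 < m * (4 / ε)), ← Real.exp_neg,
      Real.log_mul hm0.ne' (by positivity)]
    exact Real.exp_le_exp.2 (by linarith)
  calc m * (1 - (2 * m)⁻¹) ^ T ≤ m * (m * (4 / ε))⁻¹ :=
        mul_le_mul_of_nonneg_left (h2.trans h4) hm0.le
    _ = ε / 4 := by field_simp

/-- The factor 3 serves through 3 log 2 ≥ 1, and m ≤ T because log(4/ε) ≥ 1. -/
lemma mul_half_pow_le {m ε : ℝ} (hm : 1 ≤ m) (hε : 0 < ε) (hε' : ε ≤ 1 / 2) {T N : ℕ}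
    (hT : 2 * m * (Real.log m + Real.log (4 / ε)) ≤ T)
    (hN : 3 * Real.log (4 * T / ε) ≤ N) : m * (1 / 2) ^ N ≤ ε / 4 := by
  have hm0 : 0 < m := by linarith
  have hlog : 1 ≤ Real.log (4 / ε) := by
    rw [Real.le_log_iff_exp_le (by positivity), le_div_iff₀ hε]
    nlinarith [Real.exp_one_lt_d9]
  have hmT : m ≤ T := by
    nlinarith [Real.log_nonneg hm, mul_nonneg hm0.le (Real.log_nonneg hm)]
  have hT0 : (0 : ℝ) < T := hm0.trans_le hmT
  have h1 : (1 / 2 : ℝ) ^ N ≤ (4 * T / ε)⁻¹ := by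
    have h2 : (1 / 2 : ℝ) = Real.exp (-Real.log 2) := by
      rw [Real.exp_neg, Real.exp_log (by norm_num)]; norm_num
    rw [h2, ← Real.exp_nat_mul, ← Real.exp_log (by positivity : 0 < 4 * T / ε), ← Real.exp_neg]
    refine Real.exp_le_exp.2 ?_
    have hN0 : (0 : ℝ) ≤ N := Nat.cast_nonneg N
    nlinarith [Real.log_two_gt_d9]
  calc m * (1 / 2) ^ N ≤ T * (4 * T / ε)⁻¹ := mul_le_mul hmT h1 (by positivity) hT0.le
    _ = ε / 4 := by field_simp

/-- With 4 ≤ e² and n = e^L, the exponent is 2 + 3L − 37L − 5 log(1/ε), which is at most −2 −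
log(1/ε). -/
lemma mul_exp_neg_le {m n L ε : ℝ} (hL : 1 ≤ L) (hn : n = Real.exp L) (hm0 : 0 ≤ m)
    (hm : m ≤ n * n)     (hε : 0 < ε) (hε' : ε ≤ 1 / 2) :
    4 * m * (n * Real.exp (-(37 * L + 5 * Real.log (1 / ε)))) ≤ ε / 2 := by
  have hlog : 0 ≤ Real.log (1 / ε) := Real.log_nonneg (by rw [le_div_iff₀ hε]; linarith)
  have hexp2 : (4 : ℝ) ≤ Real.exp 2 := by
    have : Real.exp 2 = Real.exp 1 * Real.exp 1 := by rw [← Real.exp_add]; norm_num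
    nlinarith [Real.add_one_le_exp (1 : ℝ)]
  have hε2 : ε = Real.exp (-Real.log (1 / ε)) := by
    rw [one_div, Real.log_inv, neg_neg, Real.exp_log hε]
  have hhalf : Real.exp (-2) ≤ 1 / 2 := by
    rw [Real.exp_neg, inv_eq_one_div]
    exact one_div_le_one_div_of_le (by norm_num) (by linarith)
  have hn0 : 0 < n := hn ▸ Real.exp_pos L
  calc 4 * m * (n * Real.exp (-(37 * L + 5 * Real.log (1 / ε))))
      ≤ Real.exp 2 * (n * n) * (n * Real.exp (-(37 * L + 5 * Real.log (1 / ε)))) := by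
        gcongr
    _ = Real.exp (2 + (L + L) + (L + -(37 * L + 5 * Real.log (1 / ε)))) := by
        rw [hn]; simp only [Real.exp_add]
    _ ≤ Real.exp (-Real.log (1 / ε) + -2) := Real.exp_le_exp.2 (by linarith)
    _ = ε * Real.exp (-2) := by rw [Real.exp_add, ← hε2]
    _ ≤ ε / 2 := by
        have := mul_le_mul_of_nonneg_left hhalf hε.le
        linarith

lemma card_edgeSet_le {V : Type*} [Fintype V] (G : SimpleGraph V) [Fintype G.edgeSet] :
    (Fintype.card G.edgeSet : ℝ) ≤ Fintype.card V * Fintype.card V := by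
  have h1 : Fintype.card G.edgeSet ≤ (Fintype.card V).choose 2 := by
    rw [← SimpleGraph.edgeFinset_card]
    exact SimpleGraph.card_edgeFinset_le_card_choose_two
  have h2 := h1.trans (Nat.choose_le_pow (Fintype.card V) 2)
  rw [pow_two] at h2
  exact_mod_cast h2

end Estimates

end ParallelRC

end

/-! ### Choice of parameters and conclusion. -/

theorem theorem4p3 {V : Type*} [Fintype V] [DecidableEq V]
    (G : SimpleGraph V) [DecidableRel G.Adj] [Nonempty G.edgeSet]
    (p : G.edgeSet → ℝ) (hp : ∀ e, 0 < p e ∧ p e < 1)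
    (lam : V → ℝ) (hlam : ∀ v, 0 ≤ lam v ∧ lam v < 1)
    (ε : ℝ) (hε : 0 < ε) (hε' : ε ≤ 1 / 2)
    (hn : 3 ≤ Fintype.card V)
    (hlow : (1 - ⨅ e, p e) * Real.log (Fintype.card V) ≤
      min (Real.exp (-40) * Real.exp (-(5 * Real.log (1 / ε) / Real.log (Fintype.card V))))
        ((1 - ⨆ v, lam v) / 27))
    (TGD TPA : ℕ)
    (hTGD : ⌈2 * (Fintype.card G.edgeSet : ℝ) *
      (Real.log (Fintype.card G.edgeSet) + Real.log (4 / ε))⌉ ≤ (TGD : ℤ))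
    (hTPA : ⌈3 * Real.log (4 * (TGD : ℝ) / ε)⌉ ≤ (TPA : ℤ)) :
    ParallelRC.tvDist (ParallelRC.outputProb (ParallelRC.rcDist G p lam) TGD TPA)
      (ParallelRC.rcDist G p lam) ≤ ε := by
  classical
  open ParallelRC in
  let _ : MeasurableSpace G.edgeSet := ⊤
  have : DiscreteMeasurableSpace G.edgeSet := ⟨fun _ => trivial⟩
  have : Nonempty V := Fintype.card_pos_iff.1 (by omega)
  set L := Real.log (Fintype.card V) with hLdef
  set q := 1 - ⨅ e, p e with hq
  set x := ⨆ v, lam v with hx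
  have hL : 1 ≤ L := one_le_log_of_three_le hn
  have hpq : ∀ e, 1 - p e ≤ q := fun e =>
    sub_le_sub_left (ciInf_le (Set.finite_range p).bddBelow e) 1
  have hq0 : 0 < q := (sub_pos.2 (hp (Classical.arbitrary _)).2).trans_le (hpq _)
  have hlx : ∀ v, lam v ≤ x := le_ciSup (Set.finite_range lam).bddAbove
  have hx0 : 0 ≤ x := (hlam (Classical.arbitrary V)).1.trans (hlx _)
  have hx1 : x < 1 := by
    obtain ⟨v, hv⟩ := exists_eq_ciSup_of_finite (f := lam)
    rw [hx, ← hv]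
    exact (hlam v).2
  obtain ⟨hlow1, hlow2⟩ := le_min_iff.1 hlow
  have hqL : q ≤ q * L := le_mul_of_one_le_right hq0.le hL
  -- Here q(1 + L) ≤ 2qL ≤ 2(1 − x)/27, so the contraction constant is at most 4/27.
  have hδ : 2 * (q * (1 + L) / (1 - x)) ≤ 1 / 2 := by
    have : q * (1 + L) / (1 - x) ≤ 2 / 27 := by
      rw [div_le_iff₀ (by linarith)]; linarith
    linarith
  have h0 : ∀ v, 0 ≤ lam v := fun v => (hlam v).1
  have h1 : ∀ v, lam v ≤ 1 := fun v => (hlam v).2.le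
  have hl0 : 0 < 1 - 2 * q := by linarith
  have hl1 : 1 - 2 * q < 1 := by linarith
  set c := 5 * Real.log (1 / ε) with hc
  have hc0 : 0 ≤ c := by
    have : 0 ≤ Real.log (1 / ε) := Real.log_nonneg (by rw [le_div_iff₀ hε]; linarith)
    positivity
  set η := Real.exp (-(37 * L + c)) with hη
  set m : ℝ := (Fintype.card G.edgeSet : ℝ) with hmdef
  have hm : 1 ≤ m := Nat.one_le_cast.2 Fintype.card_pos
  let f : Finset G.edgeSet → ℝ := fun S => if SmallBoundary L S then 0 else 1
  have hf0 : ∀ S, 0 ≤ f S := fun S => by simp only [f]; split_ifs <;> norm_num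
  have hf : Antitone f := by
    intro S S' h
    by_cases hS : SmallBoundary L S
    · simp only [f, if_pos hS, if_pos (hS.mono h), le_refl]
    · simp only [f, if_neg hS]; split_ifs <;> norm_num
  have hβ := sum_prodLaw_not_smallBoundary_le G (L := L) (η := η) hl0 hl1 (Real.exp_pos _).le
    fun b k hk hb => by
      rw [sub_sub_cancel]
      exact two_mul_pow_le_of_boundary hq0 hL hc0 hlow1 hη hk hb
  have hcontr : ∀ S W, ∑ e, |marginal (rcDist G p lam) e S - marginal (rcDist G p lam) e W| ≤
      1 / 2 * ((symmDiff S W).card : ℝ) + m * (f S + f W) := by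
    intro S W
    by_cases hSW : SmallBoundary L S ∧ SmallBoundary L W
    · have h2 := sum_abs_marginal_sub_le h0 h1 hlx hx1 hp hpq (by linarith : 0 ≤ L) hSW.1 hSW.2
      have h3 : f S + f W = 0 := by simp only [f, if_pos hSW.1, if_pos hSW.2, add_zero]
      rw [h3, mul_zero, add_zero]
      exact h2.trans (mul_le_mul_of_nonneg_right hδ (Nat.cast_nonneg _))
    -- If a boundary is large, the trivial bound m on the sum is absorbed by the `f` term.
    · have h3 : 1 ≤ f S + f W := by
        rcases not_and_or.1 hSW with h | h
        · have : f S = 1 := if_neg h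
          linarith [hf0 W]
        · have : f W = 1 := if_neg h
          linarith [hf0 S]
      have h4 : ∑ e, |marginal (rcDist G p lam) e S - marginal (rcDist G p lam) e W| ≤ m := by
        have h5 : ∀ e, |marginal (rcDist G p lam) e S - marginal (rcDist G p lam) e W| ≤ 1 := by
          intro e
          have hpos := rcDist_pos (G := G) hp h0
          have := marginal_nonneg hpos e S
          have := marginal_nonneg hpos e W
          have := marginal_le_one hpos e S
          have := marginal_le_one hpos e W
          exact abs_le.2 ⟨by linarith, by linarith⟩
        refine (Finset.sum_le_sum fun e _ => h5 e).trans (le_of_eq ?_)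
        simp [hmdef]
      have h5 : m * 1 ≤ m * (f S + f W) := mul_le_mul_of_nonneg_left h3 (by linarith)
      have h6 : 0 ≤ 1 / 2 * ((symmDiff S W).card : ℝ) := by positivity
      linarith
  have hT : 2 * m * (Real.log m + Real.log (4 / ε)) ≤ TGD := by
    exact_mod_cast Int.ceil_le.1 hTGD
  have hN : 3 * Real.log (4 * TGD / ε) ≤ TPA := by
    exact_mod_cast Int.ceil_le.1 hTPA
  have hV : (Fintype.card V : ℝ) = Real.exp L := by
    rw [hLdef, Real.exp_log (Nat.cast_pos.2 Fintype.card_pos)]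
  have hmain := tvDist_outputProb_le (rcDist_pos hp h0) (sum_rcDist hp h0) hl0 hl1
    (one_sub_two_mul_le_marginal h0 h1 hp hpq) hf (by positivity) hβ hcontr TGD TPA
  -- Error budget: ε/4 for mixing, ε/4 for the number of rounds, ε/2 for large boundaries.
  have hA := mul_one_sub_pow_le hm hε hT
  have hB := mul_half_pow_le hm hε hε' hT hN
  have hC := mul_exp_neg_le hL hV (Nat.cast_nonneg _) (card_edgeSet_le G) hε hε'
  rw [← hmdef, mul_add] at hmain
  rw [← hc, ← hη, ← hmdef] at hC
  linarith
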